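/- **Setting.** Let $n\ge 1$, let $M$ be a smooth manifold, $E$ an oriented smooth real vector bundle over $M$ of rank $4n$, $h$ a neutral metric of $E$ (a smooth field of symmetric bilinear forms of signature $(2n,2n)$ on the fibres), and $\nabla$ a connection of $E$ with $\nabla h=0$. Frames $e=(e_1,\dots,e_{4n})$ are smooth and written as rows. Such a frame is *pseudo-orthonormal* if $h(e_i,e_j)=0$ for $i\ne j$, $h(e_i,e_i)=1$ for $i\le 2n$ and $h(e_i,e_i)=-1$ for $i>2n$. Let $$\Lambda_n=\begin{bmatrix} O_n&-I_n&O_n&I_n\\ I_n&O_n&I_n&O_n\\ O_n&I_n&O_n&-I_n\\ I_n&O_n&I_n&O_n\end{bmatrix},$$ let $G=\{A\in SO(2n,2n) : A\Lambda_n=\Lambda_nA\}$, and for $\varepsilon\in\{+1,-1\}$ let $I'_{4n,\varepsilon}$ be the $4n\times 4n$ diagonal matrix with entry $\varepsilon$ in position $3n+1$ and all other diagonal entries equal to $1$. Here $SO(2n,2n)$ is the group of real matrices of determinant $1$ that preserve $\mathrm{diag}(I_{2n},-I_{2n})$. An *$\varepsilon$-nilpotent structure* of $(E,h)$ is a smooth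 section $N$ of $\mathrm{End}\,E$ such that near each point of $M$ there is an *admissible frame field* of $N$, that is, a pseudo-orthonormal local frame field $e$ of $(E,h)$ giving the orientation of $E$ with $N e I'_{4n,\varepsilon}=eI'_{4n,\varepsilon}\Lambda_n$. Let $K$ be a Lie subgroup (an injectively immersed one, not necessarily closed) of $SO(2n,2n)$. An $\varepsilon$-nilpotent structure $N$ is a *$K$-nilpotent structure* of $(E,h,\nabla)$ if there are an open cover $\{U_\lambda\}_{\lambda\in L}$ of $M$ and admissible frame fields $e_\lambda$ of $N$ on $U_\lambda$ such that - whenever $U_\lambda\cap U_\mu\ne\emptyset$, one has $e_\mu I'_{4n,\varepsilon}=e_\lambda I'_{4n,\varepsilon}A_{\lambda\mu}$ on $U_\lambda\cap U_\mu$ for a $K$-valued function $A_{\lambda\mu}$; - for each $\lambda$, the connection form $\omega_\lambda$ defined by $\nabla(e_\lambda I'_{4n,\varepsilon})=e_\lambda I'_{4n,\varepsilon}\,\omega_\lambda$ takes its values in the Lie algebra of $K$. Given such a family, an admissible frame field $e$ of $N$ on an open set $V$ is *$K$-admissible* if for every $\lambda$ with $V\cap U_\lambda\ne\emptyset$ there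 is a $K$-valued function $A_\lambda$ on $V\cap U_\lambda$ with $eI'_{4n,\varepsilon}=e_\lambda I'_{4n,\varepsilon}A_\lambda$. **Proposition.** Suppose that $\nabla$ is flat, that is, its curvature tensor vanishes, and let $K$ be a Lie subgroup of $G$. Let $\varepsilon\in\{+1,-1\}$ and let $N$ be an $\varepsilon$-nilpotent structure which is a $K$-nilpotent structure of $(E,h,\nabla)$, with family $\{(U_\lambda,e_\lambda)\}_{\lambda\in L}$. Then each point of $M$ has an open neighbourhood $V$ on which there is a $K$-admissible frame field $e=(e_1,\dots,e_{4n})$ of $N$ with $\nabla e_i=0$ on $V$ for $i=1,\dots,4n$. -/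

import Mathlib

open Bundle VectorField
open scoped Manifold ContDiff Matrix Kronecker

namespace NeutralBundle

/-- The index set of a frame of a bundle of rank `4n`: the pair `(k, i)` (with `k = 0, 1, 2, 3` and
`i = 0, …, n - 1`) stands for the position `k n + i + 1` among `1, …, 4n`, so that a matrix indexed
by it is a `4 × 4` array of `n × n` blocks. -/
abbrev Idx (n : ℕ) : Type := Fin 4 × Fin n

/-- The Gram matrix `diag(I_{2n}, -I_{2n})` of a pseudo-orthonormal frame: the first `2n` vectors
are space-like and the last `2n` are time-like. -/
def gram (n : ℕ) : Matrix (Idx n) (Idx n) ℝ :=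
  Matrix.diagonal fun p => if p.1 < 2 then 1 else -1

/-- The matrix `Λ_n`. -/
def Lam (n : ℕ) : Matrix (Idx n) (Idx n) ℝ :=
  !![0, -1, 0, 1;
     1, 0, 1, 0;
     0, 1, 0, -1;
     1, 0, 1, 0] ⊗ₖ (1 : Matrix (Fin n) (Fin n) ℝ)

/-- The matrix `I'_{4n, ε}`: the identity, except for the entry `ε` in the position `3n + 1` of the
diagonal. -/
def signMatrix (n : ℕ) (ε : ℤˣ) : Matrix (Idx n) (Idx n) ℝ :=
  Matrix.diagonal fun p => if p.1 = 3 ∧ (p.2 : ℕ) = 0 then ((ε : ℤ) : ℝ) else 1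

/-- The product `v A` of the row `v = (v_1, …, v_{4n})` of vectors with the matrix `A`. -/
def rowMul {n : ℕ} {W : Type*} [AddCommGroup W] [Module ℝ W] (v : Idx n → W)
    (A : Matrix (Idx n) (Idx n) ℝ) : Idx n → W :=
  fun b => ∑ a, A a b • v a

/-- The group `SO(2n, 2n)`. -/
def SO (n : ℕ) : Subgroup (GL (Idx n) ℝ) where
  carrier := {A | (A : Matrix (Idx n) (Idx n) ℝ)ᵀ * gram n * (A : Matrix (Idx n) (Idx n) ℝ) = gram n
    ∧ (A : Matrix (Idx n) (Idx n) ℝ).det = 1}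
  one_mem' := by simp
  mul_mem' := by
    rintro A B ⟨hA, hA'⟩ ⟨hB, hB'⟩
    refine ⟨?_, by simp [hA', hB']⟩
    calc ((A * B : GL (Idx n) ℝ) : Matrix (Idx n) (Idx n) ℝ)ᵀ * gram n
          * ((A * B : GL (Idx n) ℝ) : Matrix (Idx n) (Idx n) ℝ)
        = (B : Matrix (Idx n) (Idx n) ℝ)ᵀ * ((A : Matrix (Idx n) (Idx n) ℝ)ᵀ * gram n
          * (A : Matrix (Idx n) (Idx n) ℝ)) * (B : Matrix (Idx n) (Idx n) ℝ) := by
          simp [Matrix.transpose_mul, Matrix.mul_assoc]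
      _ = gram n := by rw [hA, hB]
  inv_mem' := by
    rintro A ⟨hA, hA'⟩
    have h1 : (A : Matrix (Idx n) (Idx n) ℝ) * ((A⁻¹ : GL (Idx n) ℝ) : Matrix (Idx n) (Idx n) ℝ)
        = 1 := A.mul_inv
    have h2 : ((A⁻¹ : GL (Idx n) ℝ) : Matrix (Idx n) (Idx n) ℝ)ᵀ
        * (A : Matrix (Idx n) (Idx n) ℝ)ᵀ = 1 := by
      rw [← Matrix.transpose_mul, h1, Matrix.transpose_one]
    refine ⟨?_, ?_⟩
    · calc ((A⁻¹ : GL (Idx n) ℝ) : Matrix (Idx n) (Idx n) ℝ)ᵀ * gram n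
            * ((A⁻¹ : GL (Idx n) ℝ) : Matrix (Idx n) (Idx n) ℝ)
          = (((A⁻¹ : GL (Idx n) ℝ) : Matrix (Idx n) (Idx n) ℝ)ᵀ
            * (A : Matrix (Idx n) (Idx n) ℝ)ᵀ) * gram n * ((A : Matrix (Idx n) (Idx n) ℝ)
            * ((A⁻¹ : GL (Idx n) ℝ) : Matrix (Idx n) (Idx n) ℝ)) := by
            nth_rewrite 1 [← hA]
            simp only [Matrix.mul_assoc]
        _ = gram n := by rw [h1, h2, Matrix.one_mul, Matrix.mul_one]
    · have h3 := congrArg Matrix.det h1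
      rw [Matrix.det_mul, hA', one_mul, Matrix.det_one] at h3
      exact h3

/-- The subgroup `G` of `SO(2n, 2n)` of the matrices that commute with `Λ_n`. -/
def G (n : ℕ) : Subgroup (GL (Idx n) ℝ) where
  carrier := {A | A ∈ SO n ∧ (A : Matrix (Idx n) (Idx n) ℝ) * Lam n = Lam n * A}
  one_mem' := ⟨one_mem _, by simp⟩
  mul_mem' := by
    rintro A B ⟨hA, hA'⟩ ⟨hB, hB'⟩
    refine ⟨mul_mem hA hB, ?_⟩
    simp only [Units.val_mul]
    rw [Matrix.mul_assoc, hB', ← Matrix.mul_assoc, hA', Matrix.mul_assoc]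
  inv_mem' := by
    rintro A ⟨hA, hA'⟩
    refine ⟨inv_mem hA, ?_⟩
    have h : Commute (A : Matrix (Idx n) (Idx n) ℝ) (Lam n) := hA'
    exact (h.units_inv_left).eq

section LieSubgroup

variable {n d : ℕ} {K : Type*} [TopologicalSpace K] [ChartedSpace (EuclideanSpace ℝ (Fin d)) K]
  [Group K]

/-- A homomorphism into the general linear group, as a map into the space of square arrays of real
numbers. -/
def toArray (j : K →* GL (Idx n) ℝ) (k : K) : Idx n → Idx n → ℝ :=
  fun a b => (j k : Matrix (Idx n) (Idx n) ℝ) a b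

/-- The Lie group `K`, of dimension `d`, is a Lie subgroup of the Lie group of matrices `S` by means
of the inclusion `j`: an injective homomorphism that is a smooth immersion and takes its values
in `S`. Here `S` is meant to be one of the closed groups `SO n` and `G n`, which carry the
differentiable structure induced by the space of matrices. The topology of `K` need not be
the induced one, that is, `K` need not be closed. -/
structure IsLieSubgroup (S : Subgroup (GL (Idx n) ℝ)) (j : K →* GL (Idx n) ℝ) : Prop where
  range_le : j.range ≤ S
  injective : Function.Injective j
  contMDiff : ContMDiff (𝓡 d) 𝓘(ℝ, Idx n → Idx n → ℝ) ∞ (toArray j)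
  immersion : ∀ k : K,
    Function.Injective (mfderiv (𝓡 d) 𝓘(ℝ, Idx n → Idx n → ℝ) (toArray j) k)

/-- The Lie algebra of a Lie subgroup, as a set of matrices: the image of the tangent space at the
unit under the differential of the inclusion. -/
def lieAlg (d : ℕ) {K : Type*} [TopologicalSpace K] [ChartedSpace (EuclideanSpace ℝ (Fin d)) K]
    [Group K] (j : K →* GL (Idx n) ℝ) : Set (Matrix (Idx n) (Idx n) ℝ) :=
  {W | ∃ v : TangentSpace (𝓡 d) (1 : K),
    mfderiv (𝓡 d) 𝓘(ℝ, Idx n → Idx n → ℝ) (toArray j) (1 : K) v = fun a b => W a b}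

end LieSubgroup

section Bundle

variable {n m : ℕ}
  {M : Type*} [TopologicalSpace M] [ChartedSpace (EuclideanSpace ℝ (Fin m)) M]
  {F : Type*} [NormedAddCommGroup F] [NormedSpace ℝ F]
  {E : M → Type*} [TopologicalSpace (TotalSpace F E)]
  [∀ x, AddCommGroup (E x)] [∀ x, Module ℝ (E x)] [∀ x, TopologicalSpace (E x)]
  [∀ x, IsTopologicalAddGroup (E x)] [∀ x, ContinuousSMul ℝ (E x)]
  [FiberBundle F E]

/-- `h` is a neutral metric of the bundle `E` of rank `4n`: a smooth field of symmetric bilinear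
forms of signature `(2n, 2n)`. -/
structure IsNeutralMetric (m n : ℕ) {M : Type*} [TopologicalSpace M]
    [ChartedSpace (EuclideanSpace ℝ (Fin m)) M]
    (F : Type*) [NormedAddCommGroup F] [NormedSpace ℝ F]
    {E : M → Type*} [TopologicalSpace (TotalSpace F E)]
    [∀ x, AddCommGroup (E x)] [∀ x, Module ℝ (E x)] [∀ x, TopologicalSpace (E x)]
    [∀ x, IsTopologicalAddGroup (E x)] [∀ x, ContinuousSMul ℝ (E x)]
    [FiberBundle F E] [VectorBundle ℝ F E]
    (h : Π x, E x →L[ℝ] E x →L[ℝ] ℝ) : Prop where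
  contMDiff : ContMDiff (𝓡 m) ((𝓡 m).prod 𝓘(ℝ, F →L[ℝ] F →L[ℝ] ℝ)) ∞
    (fun x => TotalSpace.mk' (F →L[ℝ] F →L[ℝ] ℝ) x (h x))
  symm : ∀ x (v w : E x), h x v w = h x w v
  signature : ∀ x, ∃ b : Module.Basis (Idx n) ℝ (E x), ∀ p q, h x (b p) (b q) = gram n p q

/-- `o` is an orientation of the bundle `E`: a family of orientations of the fibres which, near each
point, is given by a smooth frame field. -/
def IsBundleOrientation (m : ℕ) {M : Type*} [TopologicalSpace M]
    [ChartedSpace (EuclideanSpace ℝ (Fin m)) M]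
    (F : Type*) [NormedAddCommGroup F] [NormedSpace ℝ F]
    {E : M → Type*} [TopologicalSpace (TotalSpace F E)]
    [∀ x, AddCommGroup (E x)] [∀ x, Module ℝ (E x)] [∀ x, TopologicalSpace (E x)]
    [FiberBundle F E] (o : Π x, Orientation ℝ (E x) (Idx n)) : Prop :=
  ∀ x₀ : M, ∃ (U : Set M) (s : Idx n → Π x, E x) (hs : IsLocalFrameOn (𝓡 m) F ∞ s U),
    IsOpen U ∧ x₀ ∈ U ∧ ∀ x (hx : x ∈ U), (hs.toBasisAt hx).orientation = o x

/-- `∇ h = 0`. -/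
def IsMetricConnection (h : Π x, E x →L[ℝ] E x →L[ℝ] ℝ)
    (cov : CovariantDerivative (𝓡 m) F E) : Prop :=
  ∀ (σ τ : Π x, E x) (x : M),
    MDifferentiableAt (𝓡 m) ((𝓡 m).prod 𝓘(ℝ, F)) (fun y => TotalSpace.mk' F y (σ y)) x →
    MDifferentiableAt (𝓡 m) ((𝓡 m).prod 𝓘(ℝ, F)) (fun y => TotalSpace.mk' F y (τ y)) x →
    ∀ X : TangentSpace (𝓡 m) x,
      mfderiv (𝓡 m) 𝓘(ℝ, ℝ) (fun y => h y (σ y) (τ y)) x X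
        = h x (cov σ x X) (τ x) + h x (σ x) (cov τ x X)

/-- `R(X, Y) σ = ∇_X ∇_Y σ - ∇_Y ∇_X σ - ∇_{[X, Y]} σ`. -/
noncomputable def curvature (cov : CovariantDerivative (𝓡 m) F E)
    (X Y : Π x : M, TangentSpace (𝓡 m) x) (σ : Π x, E x) (x : M) : E x :=
  cov (fun y => cov σ y (Y y)) x (X x) - cov (fun y => cov σ y (X y)) x (Y x)
    - cov σ x (mlieBracket (𝓡 m) X Y x)

/-- The curvature of `∇` vanishes on all smooth local vector fields and smooth local sections. -/
def IsFlat [IsManifold (𝓡 m) ∞ M] (cov : CovariantDerivative (𝓡 m) F E) : Prop :=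
  ∀ (U : Set M), IsOpen U → ∀ (X Y : Π x : M, TangentSpace (𝓡 m) x) (σ : Π x, E x),
    ContMDiffOn (𝓡 m) (𝓡 m).tangent ∞
      (fun y => (TotalSpace.mk' (EuclideanSpace ℝ (Fin m)) y (X y) : TangentBundle (𝓡 m) M)) U →
    ContMDiffOn (𝓡 m) (𝓡 m).tangent ∞
      (fun y => (TotalSpace.mk' (EuclideanSpace ℝ (Fin m)) y (Y y) : TangentBundle (𝓡 m) M)) U →
    ContMDiffOn (𝓡 m) ((𝓡 m).prod 𝓘(ℝ, F)) ∞ (fun y => TotalSpace.mk' F y (σ y)) U →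
      ∀ x ∈ U, curvature cov X Y σ x = 0

/-- `e` is an admissible frame field of `N` on the open set `U`: an ordered pseudo-orthonormal smooth
frame field of `(E, h)` on `U` which gives the orientation and satisfies
`N e I'_{4n, ε} = e I'_{4n, ε} Λ_n`. -/
structure IsAdmissibleFrame (m : ℕ) {M : Type*} [TopologicalSpace M]
    [ChartedSpace (EuclideanSpace ℝ (Fin m)) M]
    (F : Type*) [NormedAddCommGroup F] [NormedSpace ℝ F]
    {E : M → Type*} [TopologicalSpace (TotalSpace F E)]
    [∀ x, AddCommGroup (E x)] [∀ x, Module ℝ (E x)] [∀ x, TopologicalSpace (E x)]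
    [∀ x, IsTopologicalAddGroup (E x)] [∀ x, ContinuousSMul ℝ (E x)] [FiberBundle F E]
    (h : Π x, E x →L[ℝ] E x →L[ℝ] ℝ) (o : Π x, Orientation ℝ (E x) (Idx n)) (ε : ℤˣ)
    (N : Π x, E x →L[ℝ] E x) (U : Set M) (e : Idx n → Π x, E x) : Prop where
  isOpen : IsOpen U
  frame : IsLocalFrameOn (𝓡 m) F ∞ e U
  orthonormal : ∀ x ∈ U, ∀ p q, h x (e p x) (e q x) = gram n p q
  positive : ∀ x (hx : x ∈ U), (frame.toBasisAt hx).orientation = o x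
  nilpotent : ∀ x ∈ U,
    (fun p => N x (rowMul (fun q => e q x) (signMatrix n ε) p))
      = rowMul (rowMul (fun q => e q x) (signMatrix n ε)) (Lam n)

/-- `N` is an `ε`-nilpotent structure of `(E, h)`: a smooth section of `End E` that has an admissible
frame field near each point. (Then it is a nilpotent structure, as `e I'_{4n, ε}` is an ordered
pseudo-orthonormal frame field `f` with `N f = f Λ_n`.) -/
structure IsEpsNilpotent (m : ℕ) {M : Type*} [TopologicalSpace M]
    [ChartedSpace (EuclideanSpace ℝ (Fin m)) M]
    (F : Type*) [NormedAddCommGroup F] [NormedSpace ℝ F]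
    {E : M → Type*} [TopologicalSpace (TotalSpace F E)]
    [∀ x, AddCommGroup (E x)] [∀ x, Module ℝ (E x)] [∀ x, TopologicalSpace (E x)]
    [∀ x, IsTopologicalAddGroup (E x)] [∀ x, ContinuousSMul ℝ (E x)]
    [FiberBundle F E] [VectorBundle ℝ F E]
    (h : Π x, E x →L[ℝ] E x →L[ℝ] ℝ) (o : Π x, Orientation ℝ (E x) (Idx n)) (ε : ℤˣ)
    (N : Π x, E x →L[ℝ] E x) : Prop where
  contMDiff : ContMDiff (𝓡 m) ((𝓡 m).prod 𝓘(ℝ, F →L[ℝ] F)) ∞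
    (fun x => TotalSpace.mk' (F →L[ℝ] F) (E := fun x => E x →L[ℝ] E x) x (N x))
  exists_frame : ∀ x₀ : M, ∃ (U : Set M) (e : Idx n → Π x, E x),
    x₀ ∈ U ∧ IsAdmissibleFrame m F h o ε N U e

/-- On `U ∩ U'`, the frame fields `e'` and `e` satisfy `e' I'_{4n, ε} = e I'_{4n, ε} A` for a
function `A` valued in `K`. -/
def RelatedBy {K : Type*} [Group K] (j : K →* GL (Idx n) ℝ) (ε : ℤˣ)
    (U : Set M) (e : Idx n → Π x, E x) (U' : Set M) (e' : Idx n → Π x, E x) : Prop :=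
  ∃ A : M → K, ∀ x ∈ U ∩ U',
    rowMul (fun q => e' q x) (signMatrix n ε)
      = rowMul (rowMul (fun q => e q x) (signMatrix n ε)) (j (A x) : Matrix (Idx n) (Idx n) ℝ)

/-- `N` is a `K`-nilpotent structure of `(E, h, ∇)`, by means of the open cover `U` of `M` and the
family `e` of admissible frame fields. In `connection`, `W` is the value at the tangent vector
`X` of the connection form of `∇` with respect to `e_l I'_{4n, ε}`, that is, the matrix with
`∇_X (e_l I'_{4n, ε}) = e_l I'_{4n, ε} W`. -/
structure IsKNilpotent {d : ℕ} {K : Type*} [TopologicalSpace K]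
    [ChartedSpace (EuclideanSpace ℝ (Fin d)) K] [Group K] [VectorBundle ℝ F E]
    (j : K →* GL (Idx n) ℝ)
    (h : Π x, E x →L[ℝ] E x →L[ℝ] ℝ) (o : Π x, Orientation ℝ (E x) (Idx n))
    (cov : CovariantDerivative (𝓡 m) F E) (ε : ℤˣ) (N : Π x, E x →L[ℝ] E x)
    {L : Type*} (U : L → Set M) (e : L → Idx n → Π x, E x) : Prop where
  epsNilpotent : IsEpsNilpotent m F h o ε N
  cover : ⋃ l, U l = Set.univ
  admissible : ∀ l, IsAdmissibleFrame m F h o ε N (U l) (e l)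
  transition : ∀ l l', (U l ∩ U l').Nonempty → RelatedBy j ε (U l) (e l) (U l') (e l')
  connection : ∀ l, ∀ x ∈ U l, ∀ X : TangentSpace (𝓡 m) x, ∃ W ∈ lieAlg d j,
    (fun p => cov (fun y => rowMul (fun q => e l q y) (signMatrix n ε) p) x X)
      = rowMul (rowMul (fun q => e l q x) (signMatrix n ε)) W

/-- `f` is a `K`-admissible frame field on `V` of the `K`-nilpotent structure `N` given by the
family `(U_l, e_l)`. -/
def IsKAdmissible (m : ℕ) {M : Type*} [TopologicalSpace M]
    [ChartedSpace (EuclideanSpace ℝ (Fin m)) M]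
    (F : Type*) [NormedAddCommGroup F] [NormedSpace ℝ F]
    {E : M → Type*} [TopologicalSpace (TotalSpace F E)]
    [∀ x, AddCommGroup (E x)] [∀ x, Module ℝ (E x)] [∀ x, TopologicalSpace (E x)]
    [∀ x, IsTopologicalAddGroup (E x)] [∀ x, ContinuousSMul ℝ (E x)] [FiberBundle F E]
    {K : Type*} [Group K] (j : K →* GL (Idx n) ℝ)
    (h : Π x, E x →L[ℝ] E x →L[ℝ] ℝ) (o : Π x, Orientation ℝ (E x) (Idx n))
    (ε : ℤˣ) (N : Π x, E x →L[ℝ] E x)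
    {L : Type*} (U : L → Set M) (e : L → Idx n → Π x, E x)
    (V : Set M) (f : Idx n → Π x, E x) : Prop :=
  IsAdmissibleFrame m F h o ε N V f ∧
    ∀ l, (U l ∩ V).Nonempty → RelatedBy j ε (U l) (e l) V f

end Bundle

end NeutralBundle

/-! Choose a member `e l` of the family whose domain contains the point, and let `s = e l I'` be its
signed frame, with connection form `ω` in the Lie algebra of `K`. A frame `s u` is parallel exactly
when `du = -ω u`, and flatness, in the form `dω + ω ∧ ω = 0`, is the integrability condition of this
system. So there is a solution `u` with `u = 1` at the point. If `u` takes values in `K`, then `f =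
s u I'` is parallel and `K`-admissible: elements of `G` preserve the metric, the orientation and the
relation with `Λ_n`, and `f` differs from every `e l'` by a product of two elements of `K`.

The system is solved by parallel transport along rays (`exists_radial_solution`). Differentiability
of the resulting `u` comes from Grönwall estimates: flatness makes the first order defect between
two neighbouring rays satisfy a linear equation up to a quadratic error (`exists_parallel_at_zero`).
Smoothness follows by bootstrapping.

That `u` stays in `K` is delicate because `K` may not be closed, so its image need not be a
submanifold. However, a chart piece of `K` around the unit is embedded, with a local retraction `ρ`
onto it (`exists_retraction`), and the fields `B ↦ W B`, with `W` in the Lie algebra, are tangent to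
it. Along a ray, `u - ρ(u)` therefore satisfies a linear differential inequality with initial value
zero, hence vanishes (`exists_pos_forall_mem_range`). -/

namespace FlatLinearSystem

open Set Metric Filter
open scoped Topology

/-! ### Flat linear systems on a normed space. -/

section Gronwall

variable {S : Type*} [NormedAddCommGroup S] [NormedSpace ℝ S]

/-- A form of Grönwall's inequality on the unit interval. -/
theorem norm_le_of_norm_deriv_le {f f' : ℝ → S} {ε : ℝ} (hε : 0 ≤ ε)
    (hf : ∀ t ∈ Icc (0 : ℝ) 1, HasDerivWithinAt f (f' t) (Icc 0 1) t) (h0 : f 0 = 0)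
    (bound : ∀ t ∈ Icc (0 : ℝ) 1, ‖f' t‖ ≤ ‖f t‖ + ε) :
    ∀ t ∈ Icc (0 : ℝ) 1, ‖f t‖ ≤ 2 * ε := by
  intro t ht
  have h := norm_le_gronwallBound_of_norm_deriv_right_le (f := f) (f' := f') (δ := 0) (K := 1)
    (ε := ε) (a := 0) (b := 1) (fun s hs => (hf s hs).continuousWithinAt)
    (fun s hs => (hf s ⟨hs.1, hs.2.le⟩).mono_of_mem_nhdsWithin (Icc_mem_nhdsGE_of_mem hs))
    (by simp [h0]) (fun s hs => by simpa using bound s ⟨hs.1, hs.2.le⟩) t ht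
  refine h.trans ?_
  -- With zero initial value and rate 1, the Grönwall bound is `ε (exp t - 1)`; the constant 2 is `3
  -- - 1`.
  have h3 : Real.exp t ≤ 3 :=
    (Real.exp_le_exp.2 ht.2).trans (Real.exp_one_lt_d9.le.trans (by norm_num))
  rw [gronwallBound_of_K_ne_0 one_ne_zero]
  simp only [zero_mul, div_one, one_mul, sub_zero, zero_add]
  nlinarith

end Gronwall

section Parallel

set_option synthInstance.maxHeartbeats 200000

variable {V S : Type*} [NormedAddCommGroup V] [NormedSpace ℝ V]
  [NormedAddCommGroup S] [NormedSpace ℝ S]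

/-- Local bounds for a map of class `C^2`. -/
theorem exists_bounds_of_contDiffAt {f : V → S} {x₀ : V} (hf : ContDiffAt ℝ 2 f x₀) :
    ∃ C : ℝ, 0 ≤ C ∧ ∀ᶠ r in 𝓝[>] (0 : ℝ), ∀ x ∈ ball x₀ r, DifferentiableAt ℝ f x ∧ ‖f x‖ ≤ C ∧
      ‖fderiv ℝ f x‖ ≤ C ∧ ∀ y ∈ ball x₀ r, ‖f y - f x‖ ≤ C * ‖y - x‖ ∧
        ‖f y - f x - fderiv ℝ f x (y - x)‖ ≤ C * ‖y - x‖ ^ 2 := by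
  have hf1 : ContDiffAt ℝ 1 f x₀ := hf.of_le (by norm_num)
  have hdf : ContDiffAt ℝ 1 (fderiv ℝ f) x₀ := hf.fderiv_right (by norm_num)
  obtain ⟨K₁, t₁, ht₁, hK₁⟩ := hf1.exists_lipschitzOnWith
  obtain ⟨K₂, t₂, ht₂, hK₂⟩ := hdf.exists_lipschitzOnWith
  have e1 : ∀ᶠ x in 𝓝 x₀, DifferentiableAt ℝ f x :=
    (hf1.eventually (by simp)).mono fun x hx => hx.differentiableAt one_ne_zero
  have e2 : ∀ᶠ x in 𝓝 x₀, ‖f x‖ < ‖f x₀‖ + 1 :=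
    hf1.continuousAt.norm.eventually_lt_const (lt_add_one _)
  have e3 : ∀ᶠ x in 𝓝 x₀, ‖fderiv ℝ f x‖ < ‖fderiv ℝ f x₀‖ + 1 :=
    hdf.continuousAt.norm.eventually_lt_const (lt_add_one _)
  obtain ⟨R, hR, hball⟩ := Metric.eventually_nhds_iff_ball.1
    (e1.and (e2.and (e3.and ((eventually_mem_set.2 ht₁).and (eventually_mem_set.2 ht₂)))))
  refine ⟨max (max (‖f x₀‖ + 1) (‖fderiv ℝ f x₀‖ + 1)) (max K₁ K₂), by positivity, ?_⟩
  set C := max (max (‖f x₀‖ + 1) (‖fderiv ℝ f x₀‖ + 1)) (max (K₁ : ℝ) K₂)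
  have hC1 : ‖f x₀‖ + 1 ≤ C := (le_max_left _ _).trans (le_max_left _ _)
  have hC2 : ‖fderiv ℝ f x₀‖ + 1 ≤ C := (le_max_right _ _).trans (le_max_left _ _)
  have hC3 : (K₁ : ℝ) ≤ C := (le_max_left _ _).trans (le_max_right _ _)
  have hC4 : (K₂ : ℝ) ≤ C := (le_max_right _ _).trans (le_max_right _ _)
  filter_upwards [Ioo_mem_nhdsGT hR] with r hr x hx
  have hsub : ball x₀ r ⊆ ball x₀ R := ball_subset_ball hr.2.le
  obtain ⟨h1, h2, h3, h4, h5⟩ := hball x (hsub hx)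
  refine ⟨h1, h2.le.trans hC1, h3.le.trans hC2, fun y hy => ⟨?_, ?_⟩⟩
  · have := hK₁.norm_sub_le (hball y (hsub hy)).2.2.2.1 h4
    exact this.trans (by gcongr)
  -- Taylor remainder: the mean value inequality on the segment, along which the derivative differs
  -- from its value at `x` by at most `C ‖y - x‖`.
  · have hseg : segment ℝ x y ⊆ ball x₀ R := (convex_ball x₀ R).segment_subset (hsub hx) (hsub hy)
    have := Convex.norm_image_sub_le_of_norm_hasFDerivWithin_le' (f := f) (f' := fderiv ℝ f)
      (φ := fderiv ℝ f x) (C := C * ‖y - x‖) (s := segment ℝ x y) (x := x) (y := y)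
      (fun z hz => (hball z (hseg hz)).1.hasFDerivAt.hasFDerivWithinAt)
      (fun z hz => by
        have h6 := hK₂.norm_sub_le (hball z (hseg hz)).2.2.2.2 h5
        refine h6.trans ?_
        have h7 : ‖z - x‖ ≤ ‖y - x‖ := by
          obtain ⟨θ, hθ, rfl⟩ := segment_eq_image' ℝ x y ▸ hz
          rw [add_sub_cancel_left, norm_smul, Real.norm_of_nonneg hθ.1]
          exact mul_le_of_le_one_left (norm_nonneg _) hθ.2
        gcongr)
      (convex_segment x y) (left_mem_segment ℝ x y) (right_mem_segment ℝ x y)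
    calc _ ≤ _ := this
      _ = _ := by ring

variable {Ω : V → V →L[ℝ] S →L[ℝ] S} {r C : ℝ}

theorem smul_mem_ball {x : V} (hx : x ∈ ball (0 : V) r) {t : ℝ} (ht : t ∈ Icc (0 : ℝ) 1) :
    t • x ∈ ball (0 : V) r := by
  rw [mem_ball_zero_iff] at hx ⊢
  rw [norm_smul, Real.norm_of_nonneg ht.1]
  exact (mul_le_of_le_one_left (norm_nonneg _) ht.2).trans_lt hx

/-- The smallness that makes radial transport exist up to time 1 and lets every later Grönwall
estimate run with rate 1. -/
theorem norm_apply_le_quarter (hC : 0 ≤ C) (hΩC : ∀ x ∈ ball (0 : V) r, ‖Ω x‖ ≤ C)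
    (hr : C * r ≤ 1 / 4) {x z : V} (hz : z ∈ ball (0 : V) r) (hx : x ∈ ball (0 : V) r) (s : S) :
    ‖Ω z x s‖ ≤ 1 / 4 * ‖s‖ := by
  have hx' : ‖x‖ ≤ r := (mem_ball_zero_iff.1 hx).le
  calc ‖Ω z x s‖ ≤ ‖Ω z‖ * ‖x‖ * ‖s‖ := (Ω z).le_opNorm₂ x s
    _ ≤ C * r * ‖s‖ := by gcongr; exact hΩC z hz
    _ ≤ 1 / 4 * ‖s‖ := by gcongr

/-- Parallel transport along a ray. -/
theorem exists_radial_solution [CompleteSpace S] (hC : 0 ≤ C)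
    (hΩ : ContinuousOn Ω (ball 0 r)) (hΩC : ∀ x ∈ ball (0 : V) r, ‖Ω x‖ ≤ C)
    (hr : C * r ≤ 1 / 4) (a : S) {x : V} (hx : x ∈ ball (0 : V) r) :
    ∃ g : ℝ → S, g 0 = a ∧
      ∀ t ∈ Icc (0 : ℝ) 1, HasDerivWithinAt g (-(Ω (t • x) x (g t))) (Icc 0 1) t := by
  -- On the closed ball of radius `‖a‖ + 1` about `a` one has `‖s‖ ≤ 2‖a‖ + 1`, so the speed is at
  -- most a quarter of this, below `‖a‖ + 1`: a solution cannot leave the ball in unit time.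
  have hpl : IsPicardLindelof (fun t s => -(Ω (t • x) x s)) (tmin := 0) (tmax := 1)
      ⟨0, by simp⟩ a (‖a‖₊ + 1) 0 (‖a‖₊ + 1) 1 := by
    refine ⟨fun t ht => LipschitzOnWith.of_dist_le_mul fun s _ s' _ => ?_, fun s _ => ?_,
      fun t ht s hs => ?_, by simp⟩
    · rw [dist_eq_norm, dist_eq_norm, neg_sub_neg, ← map_sub, ← norm_neg (s - s'), neg_sub]
      have := norm_apply_le_quarter hC hΩC hr (smul_mem_ball hx ht) hx (s' - s)
      simp only [NNReal.coe_one, one_mul]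
      linarith [norm_nonneg (s' - s)]
    · refine ContinuousOn.neg ?_
      have : ContinuousOn (fun t : ℝ => Ω (t • x)) (Icc 0 1) :=
        hΩ.comp (by fun_prop) fun t ht => smul_mem_ball hx ht
      exact (this.clm_apply continuousOn_const).clm_apply continuousOn_const
    · have := norm_apply_le_quarter hC hΩC hr (smul_mem_ball hx ht) hx s
      have h2 : ‖s‖ ≤ ‖a‖ + (‖a‖ + 1) := by
        have := norm_le_norm_add_norm_sub' s a
        rw [mem_closedBall, dist_eq_norm] at hs
        push_cast [coe_nnnorm] at hs
        linarith
      rw [norm_neg]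
      push_cast [coe_nnnorm]
      linarith [norm_nonneg a]
  exact hpl.exists_eq_forall_mem_Icc_hasDerivWithinAt₀

/-- The case of the origin of `exists_parallel`. -/
theorem exists_parallel_at_zero [CompleteSpace S] (hΩ : ContDiffAt ℝ 2 Ω 0)
    (hflat : ∀ᶠ x in 𝓝 (0 : V), ∀ v w : V, fderiv ℝ Ω x v w - fderiv ℝ Ω x w v
      + Ω x v ∘L Ω x w - Ω x w ∘L Ω x v = 0) (a : S) :
    ∃ r > 0, ∃ u : V → S, u 0 = a ∧
      ∀ x ∈ ball (0 : V) r, HasFDerivAt u (-((Ω x).flip (u x))) x := by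
  obtain ⟨C, hC, hbounds⟩ := exists_bounds_of_contDiffAt hΩ
  obtain ⟨R, hR, hflatR⟩ := Metric.eventually_nhds_iff_ball.1 hflat
  have hsmall : ∀ᶠ r in 𝓝[>] (0 : ℝ), C * r < 1 / 4 := by
    have : Tendsto (fun r : ℝ => C * r) (𝓝[>] 0) (𝓝 (C * 0)) :=
      ((continuous_const.mul continuous_id).tendsto 0).mono_left nhdsWithin_le_nhds
    exact this.eventually_lt_const (by norm_num)
  -- Taking also `r < 1` allows the factors `‖x‖` and `‖y‖` to be dropped from the estimates.
  obtain ⟨r, hb, hrC, hrR, hr1⟩ := (hbounds.and (hsmall.and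
    ((eventually_mem_set.2 (Ioo_mem_nhdsGT hR)).and
      (eventually_mem_set.2 (Ioo_mem_nhdsGT one_pos))))).exists
  have hr0 : 0 < r := hr1.1
  have hcont : ContinuousOn Ω (ball 0 r) := fun x hx =>
    (hb x hx).1.continuousAt.continuousWithinAt
  have hΩC : ∀ x ∈ ball (0 : V) r, ‖Ω x‖ ≤ C := fun x hx => (hb x hx).2.1
  have hquarter {x z : V} (hz : z ∈ ball (0 : V) r) (hx : x ∈ ball (0 : V) r) (s : S) :=
    norm_apply_le_quarter hC hΩC hrC.le hz hx s
  have hex : ∀ x : V, ∃ g : ℝ → S, x ∈ ball (0 : V) r → g 0 = a ∧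
      ∀ t ∈ Icc (0 : ℝ) 1, HasDerivWithinAt g (-(Ω (t • x) x (g t))) (Icc 0 1) t := by
    intro x
    by_cases hx : x ∈ ball (0 : V) r
    · obtain ⟨g, hg⟩ := exists_radial_solution hC hcont hΩC hrC.le a hx
      exact ⟨g, fun _ => hg⟩
    · exact ⟨0, fun h => absurd h hx⟩
  choose g hg using hex
  have hg0 {x : V} (hx : x ∈ ball (0 : V) r) := (hg x hx).1
  have hgd {x : V} (hx : x ∈ ball (0 : V) r) := (hg x hx).2
  have h0 : (0 : V) ∈ ball (0 : V) r := mem_ball_self hr0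
  have h1 : (1 : ℝ) ∈ Icc (0 : ℝ) 1 := by simp
  -- the value at the origin
  have hu0 : g 0 1 = a := by
    have := norm_le_of_norm_deriv_le (f := fun t => g 0 t - a)
      (f' := fun t => -(Ω (t • (0 : V)) 0 (g 0 t))) (ε := 0) le_rfl
      (fun t ht => (hgd h0 t ht).sub_const a) (by simp [hg0 h0])
      (fun t ht => by simp) 1 h1
    simpa [sub_eq_zero] using this
  have hnorm {x : V} (hx : x ∈ ball (0 : V) r) : ∀ t ∈ Icc (0 : ℝ) 1, ‖g x t‖ ≤ 2 * ‖a‖ := by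
    intro t ht
    have := norm_le_of_norm_deriv_le (f := fun t => g x t - a)
      (f' := fun t => -(Ω (t • x) x (g x t))) (ε := 1 / 4 * ‖a‖) (by positivity)
      (fun t ht => (hgd hx t ht).sub_const a) (by simp [hg0 hx])
      (fun t ht => by
        have h2 := hquarter (smul_mem_ball hx ht) hx (g x t)
        have h3 := norm_le_norm_add_norm_sub' (g x t) a
        rw [norm_neg]
        linarith [norm_nonneg (g x t - a)]) t ht
    have h3 := norm_le_norm_add_norm_sub' (g x t) a
    linarith [norm_nonneg a]
  set A := 2 * ‖a‖ with hA
  have hA0 : 0 ≤ A := by positivity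
  have hdiffΩ {x y : V} (hx : x ∈ ball (0 : V) r) (hy : y ∈ ball (0 : V) r) {t : ℝ}
      (ht : t ∈ Icc (0 : ℝ) 1) : ‖Ω (t • y) y - Ω (t • x) x‖ ≤ 2 * C * ‖y - x‖ := by
    have hx1 : ‖x‖ ≤ 1 := (mem_ball_zero_iff.1 hx).le.trans hr1.2.le
    have e : Ω (t • y) y - Ω (t • x) x = Ω (t • y) (y - x) + (Ω (t • y) - Ω (t • x)) x := by
      simp
    have hl := ((hb _ (smul_mem_ball hx ht)).2.2.2 _ (smul_mem_ball hy ht)).1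
    rw [← smul_sub, norm_smul, Real.norm_of_nonneg ht.1] at hl
    rw [e]
    calc _ ≤ ‖Ω (t • y)‖ * ‖y - x‖ + ‖Ω (t • y) - Ω (t • x)‖ * ‖x‖ :=
          (norm_add_le _ _).trans (add_le_add (ContinuousLinearMap.le_opNorm _ _)
            (ContinuousLinearMap.le_opNorm _ _))
      _ ≤ C * ‖y - x‖ + C * (1 * ‖y - x‖) * 1 := by
          gcongr
          · exact hΩC _ (smul_mem_ball hy ht)
          · refine hl.trans ?_
            gcongr
            exact ht.2
      _ = _ := by ring
  -- Transports along two rays differ to first order in `y - x`; the next estimate improves this to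
  -- second order after subtracting the expected linear term.
  have hlip {x y : V} (hx : x ∈ ball (0 : V) r) (hy : y ∈ ball (0 : V) r) :
      ∀ t ∈ Icc (0 : ℝ) 1, ‖g y t - g x t‖ ≤ 2 * (2 * C * ‖y - x‖ * A) := by
    refine norm_le_of_norm_deriv_le (f := fun t => g y t - g x t)
      (f' := fun t => -(Ω (t • y) y (g y t)) - -(Ω (t • x) x (g x t))) (by positivity)
      (fun t ht => (hgd hy t ht).sub (hgd hx t ht)) (by simp [hg0 hx, hg0 hy]) fun t ht => ?_
    have e : -(Ω (t • y) y (g y t)) - -(Ω (t • x) x (g x t))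
        = -(Ω (t • y) y (g y t - g x t)) - (Ω (t • y) y - Ω (t • x) x) (g x t) := by
      simp only [map_sub, sub_apply]
      abel
    have h2 := hquarter (smul_mem_ball hy ht) hy (g y t - g x t)
    have h3 : ‖(Ω (t • y) y - Ω (t • x) x) (g x t)‖ ≤ 2 * C * ‖y - x‖ * A :=
      (ContinuousLinearMap.le_opNorm _ _).trans (by
        gcongr
        · exact hdiffΩ hx hy ht
        · exact hnorm hx t ht)
    rw [e]
    refine (norm_sub_le _ _).trans ?_
    rw [norm_neg]
    linarith [norm_nonneg (g y t - g x t)]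
  have hmain {x y : V} (hx : x ∈ ball (0 : V) r) (hy : y ∈ ball (0 : V) r) :
      ‖g y 1 - g x 1 + Ω x (y - x) (g x 1)‖
        ≤ 2 * ((2 * C * (2 * (2 * C * A)) + 2 * C * A) * ‖y - x‖ ^ 2) := by
    have hy1 : ‖y‖ ≤ 1 := (mem_ball_zero_iff.1 hy).le.trans hr1.2.le
    set w := y - x with hw
    -- At time `t` this function is the first order defect of parallelism at `t • x` in the
    -- direction `t • w`. It vanishes at `t = 0`, and its value at `t = 1` is the remainder to be
    -- bounded.
    have key := norm_le_of_norm_deriv_le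
      (f := fun t => g y t - g x t + Ω (t • x) (t • w) (g x t))
      (f' := fun t => -(Ω (t • y) y (g y t)) - -(Ω (t • x) x (g x t)) +
        ((fderiv ℝ Ω (t • x) x (t • w) + Ω (t • x) w) (g x t)
          + Ω (t • x) (t • w) (-(Ω (t • x) x (g x t)))))
      (ε := (2 * C * (2 * (2 * C * A)) + 2 * C * A) * ‖w‖ ^ 2) (by positivity)
      (fun t ht => ?_) (by simp [hg0 hx, hg0 hy]) (fun t ht => ?_) 1 h1
    · simpa using key
    · refine ((hgd hy t ht).sub (hgd hx t ht)).add ?_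
      have d1 : HasDerivAt (fun t : ℝ => t • x) x t := by
        simpa using (hasDerivAt_id t).smul_const x
      have d2 : HasDerivAt (fun t : ℝ => t • w) w t := by
        simpa using (hasDerivAt_id t).smul_const w
      have d3 : HasDerivAt (fun t : ℝ => Ω (t • x)) (fderiv ℝ Ω (t • x) x) t :=
        HasFDerivAt.comp_hasDerivAt (l := Ω) (f := fun t : ℝ => t • x) t
          (hb _ (smul_mem_ball hx ht)).1.hasFDerivAt d1
      exact (d3.clm_apply d2).hasDerivWithinAt.clm_apply (hgd hx t ht)
    · have hf := congrArg (fun T : S →L[ℝ] S => T (g x t))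
        (hflatR (t • x) (ball_subset_ball hrR.2.le (smul_mem_ball hx ht)) x (t • w))
      simp only [sub_apply, add_apply,
        zero_apply, ContinuousLinearMap.comp_apply] at hf
      -- The derivative is `-Ω (t • x) x` applied to the defect itself, plus terms of second order
      -- in `w`: a product of two first order differences, a Taylor remainder, and a term with `w`
      -- in two arguments.
      have e : -(Ω (t • y) y (g y t)) - -(Ω (t • x) x (g x t)) +
          ((fderiv ℝ Ω (t • x) x (t • w) + Ω (t • x) w) (g x t)
            + Ω (t • x) (t • w) (-(Ω (t • x) x (g x t))))
          = -(Ω (t • x) x (g y t - g x t + Ω (t • x) (t • w) (g x t)))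
            - (Ω (t • y) y - Ω (t • x) x) (g y t - g x t)
            - ((Ω (t • y) - Ω (t • x) - fderiv ℝ Ω (t • x) (t • w)) y
                + fderiv ℝ Ω (t • x) (t • w) w) (g x t) := by
        -- Flatness exchanges the two arguments of the derivative of `Ω`; the commutator it produces
        -- completes the defect.
        have e2 : fderiv ℝ Ω (t • x) x (t • w) (g x t)
            = fderiv ℝ Ω (t • x) (t • w) x (g x t) - Ω (t • x) x (Ω (t • x) (t • w) (g x t))
              + Ω (t • x) (t • w) (Ω (t • x) x (g x t)) := by
          rw [← sub_eq_zero, ← hf]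
          abel
        have e3 : y = x + w := by rw [hw]; abel
        simp only [sub_apply, add_apply, map_sub, map_add,
          map_neg, e2]
        rw [show fderiv ℝ Ω (t • x) (t • w) y = fderiv ℝ Ω (t • x) (t • w) x
          + fderiv ℝ Ω (t • x) (t • w) w by conv_lhs => rw [e3, map_add],
          show Ω (t • x) y = Ω (t • x) x + Ω (t • x) w by conv_lhs => rw [e3, map_add]]
        simp only [add_apply]
        abel
      have b1 := hquarter (smul_mem_ball hx ht) hx (g y t - g x t + Ω (t • x) (t • w) (g x t))
      have b2 : ‖(Ω (t • y) y - Ω (t • x) x) (g y t - g x t)‖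
          ≤ 2 * C * ‖w‖ * (2 * (2 * C * ‖w‖ * A)) :=
        (ContinuousLinearMap.le_opNorm _ _).trans (by
          gcongr
          · exact hdiffΩ hx hy ht
          · exact hlip hx hy t ht)
      have htw : ‖t • w‖ ≤ ‖w‖ := by
        rw [norm_smul, Real.norm_of_nonneg ht.1]
        exact mul_le_of_le_one_left (norm_nonneg _) ht.2
      have b3 : ‖Ω (t • y) - Ω (t • x) - fderiv ℝ Ω (t • x) (t • w)‖ ≤ C * ‖w‖ ^ 2 := by
        have := ((hb _ (smul_mem_ball hx ht)).2.2.2 _ (smul_mem_ball hy ht)).2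
        rw [← smul_sub, ← hw] at this
        exact this.trans (by gcongr)
      have b4 : ‖fderiv ℝ Ω (t • x) (t • w) w‖ ≤ C * ‖w‖ * ‖w‖ :=
        (ContinuousLinearMap.le_opNorm₂ _ _ _).trans (by
          gcongr
          exact (hb _ (smul_mem_ball hx ht)).2.2.1)
      have b5 : ‖((Ω (t • y) - Ω (t • x) - fderiv ℝ Ω (t • x) (t • w)) y
                + fderiv ℝ Ω (t • x) (t • w) w) (g x t)‖
          ≤ (C * ‖w‖ ^ 2 * 1 + C * ‖w‖ * ‖w‖) * A :=
        (ContinuousLinearMap.le_opNorm _ _).trans (by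
          gcongr
          · refine (norm_add_le _ _).trans (add_le_add ?_ b4)
            exact (ContinuousLinearMap.le_opNorm _ _).trans (by gcongr)
          · exact hnorm hx t ht)
      rw [e]
      refine (norm_sub_le _ _).trans ((add_le_add_left (norm_sub_le _ _) _).trans ?_)
      rw [norm_neg]
      nlinarith [norm_nonneg (g y t - g x t + Ω (t • x) (t • w) (g x t))]
  refine ⟨r, hr0, fun x => g x 1, hu0, fun x hx => ?_⟩
  have hO : (fun y => g y 1 - g x 1 + Ω x (y - x) (g x 1)) =O[𝓝 x] fun y => ‖y - x‖ ^ 2 := by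
    refine Asymptotics.IsBigO.of_bound (2 * (2 * C * (2 * (2 * C * A)) + 2 * C * A)) ?_
    filter_upwards [isOpen_ball.mem_nhds hx] with y hy
    rw [Real.norm_of_nonneg (by positivity)]
    calc _ ≤ _ := hmain hx hy
      _ = _ := by ring
  have hd : HasFDerivAt (fun y => g y 1 - g x 1 + Ω x (y - x) (g x 1)) (0 : V →L[ℝ] S) x :=
    hO.hasFDerivAt one_lt_two
  have hlin : HasFDerivAt (fun y => Ω x (y - x) (g x 1)) ((Ω x).flip (g x 1)) x := by
    have := (((Ω x).flip (g x 1)).hasFDerivAt (x := x)).sub_const ((Ω x).flip (g x 1) x)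
    exact this.congr_of_eventuallyEq (Eventually.of_forall fun y => by simp)
  have := (hd.sub hlin).add_const (g x 1)
  rw [zero_sub] at this
  exact this.congr_of_eventuallyEq (Eventually.of_forall fun y => by simp)

/-- A flat linear connection on a trivial bundle has parallel sections with arbitrary values at a
point. -/
theorem exists_parallel [CompleteSpace S] {x₀ : V} (hΩ : ContDiffAt ℝ 2 Ω x₀)
    (hflat : ∀ᶠ x in 𝓝 x₀, ∀ v w : V, fderiv ℝ Ω x v w - fderiv ℝ Ω x w v
      + Ω x v ∘L Ω x w - Ω x w ∘L Ω x v = 0) (a : S) :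
    ∃ r > 0, ∃ u : V → S, u x₀ = a ∧
      ∀ x ∈ ball x₀ r, HasFDerivAt u (-((Ω x).flip (u x))) x := by
  obtain ⟨r, hr, u, hu0, hu⟩ := exists_parallel_at_zero (Ω := fun z => Ω (x₀ + z))
    (by
      refine ContDiffAt.comp (0 : V) (g := Ω) (f := fun z => x₀ + z) (by simpa using hΩ) ?_
      fun_prop)
    (by
      have hc : Tendsto (fun z : V => x₀ + z) (𝓝 0) (𝓝 x₀) := by
        simpa using (by fun_prop : Continuous fun z : V => x₀ + z).tendsto 0
      filter_upwards [hc.eventually hflat] with z hz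
      have e : fderiv ℝ (fun z => Ω (x₀ + z)) z = fderiv ℝ Ω (x₀ + z) :=
        fderiv_comp_add_left (𝕜 := ℝ) (f := Ω) x₀
      rwa [e]) a
  refine ⟨r, hr, fun x => u (x - x₀), by simpa using hu0, fun x hx => ?_⟩
  have hx' : x - x₀ ∈ ball (0 : V) r := by
    rwa [mem_ball_zero_iff, ← dist_eq_norm]
  have := (hu _ hx').comp x ((hasFDerivAt_id x).sub_const x₀)
  simpa using! this

theorem contDiffOn_flip {s : Set V} {n : ℕ∞ω} (hΩ : ContDiffOn ℝ n Ω s) :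
    ContDiffOn ℝ n (fun x => (Ω x).flip) s := by
  have h : ContDiff ℝ n (ContinuousLinearMap.flipₗᵢ ℝ V S S) := LinearIsometryEquiv.contDiff _
  exact h.comp_contDiffOn hΩ

/-- Parallel sections of a smooth linear connection are smooth. -/
theorem contDiffOn_of_parallel {s : Set V} (hs : IsOpen s) (hΩ : ContDiffOn ℝ ∞ Ω s) {u : V → S}
    (hu : ∀ x ∈ s, HasFDerivAt u (-((Ω x).flip (u x))) x) : ContDiffOn ℝ ∞ u s := by
  -- Bootstrapping: the derivative of `u` is an expression in `Ω` and `u`, hence of the same class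
  -- as `u`.
  refine contDiffOn_infty.2 fun n => ?_
  induction n with
  | zero =>
    exact contDiffOn_zero.2 fun x hx => (hu x hx).continuousAt.continuousWithinAt
  | succ n ih =>
    push_cast
    rw [contDiffOn_succ_iff_fderiv_of_isOpen hs]
    refine ⟨fun x hx => (hu x hx).differentiableAt.differentiableWithinAt, by simp, ?_⟩
    have hΩn : ContDiffOn ℝ n Ω s := hΩ.of_le (by exact_mod_cast le_top)
    have : ContDiffOn ℝ n (fun x => -((Ω x).flip (u x))) s :=
      ((contDiffOn_flip hΩn).clm_apply ih).neg
    exact this.congr fun x hx => (hu x hx).fderiv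

end Parallel

end FlatLinearSystem

/-! ### Lie subgroups: tangency of invariant fields and integration. -/

namespace NeutralBundle

open Set Metric Filter
open scoped Topology

/-- Multiplication by a matrix on the left, on the space of square arrays. -/
noncomputable def leftMul (n : ℕ) :
    Matrix (Idx n) (Idx n) ℝ →ₗ[ℝ] ((Idx n → Idx n → ℝ) →L[ℝ] (Idx n → Idx n → ℝ)) where
  toFun W := LinearMap.toContinuousLinearMap
    { toFun := fun B => Matrix.of.symm (W * Matrix.of B)
      map_add' := fun B B' => by
        rw [← Matrix.of_add_of, Matrix.mul_add]
        rfl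
      map_smul' := fun c B => by
        rw [← Matrix.smul_of, Matrix.mul_smul]
        rfl }
  map_add' W W' := by
    ext1 B
    exact congrArg Matrix.of.symm (Matrix.add_mul W W' (Matrix.of B))
  map_smul' c W := by
    ext1 B
    exact congrArg Matrix.of.symm (Matrix.smul_mul c W (Matrix.of B))

theorem leftMul_apply {n : ℕ} (W : Matrix (Idx n) (Idx n) ℝ) (B : Idx n → Idx n → ℝ) :
    leftMul n W B = Matrix.of.symm (W * Matrix.of B) := rfl

/-- Multiplication by a matrix on the right, on the space of square arrays. -/
noncomputable def rightMul {n : ℕ} (A : Matrix (Idx n) (Idx n) ℝ) :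
    (Idx n → Idx n → ℝ) →L[ℝ] (Idx n → Idx n → ℝ) :=
  LinearMap.toContinuousLinearMap
    { toFun := fun B => Matrix.of.symm (Matrix.of B * A)
      map_add' := fun B B' => by
        rw [← Matrix.of_add_of, Matrix.add_mul]
        rfl
      map_smul' := fun c B => by
        rw [← Matrix.smul_of, Matrix.smul_mul]
        rfl }

section LieSubgroup

variable {n d : ℕ} {K : Type*} [TopologicalSpace K]
  [ChartedSpace (EuclideanSpace ℝ (Fin d)) K] [Group K] [LieGroup (𝓡 d) ∞ K]
  {j : K →* GL (Idx n) ℝ}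

/-- The inclusion of a Lie subgroup, in the chart at the unit. -/
noncomputable def arrayInChart (d : ℕ) {K : Type*} [TopologicalSpace K]
    [ChartedSpace (EuclideanSpace ℝ (Fin d)) K] [Group K] (j : K →* GL (Idx n) ℝ) :
    EuclideanSpace ℝ (Fin d) → Idx n → Idx n → ℝ :=
  toArray j ∘ (extChartAt (𝓡 d) (1 : K)).symm

theorem contDiffOn_arrayInChart
    (hj : ContMDiff (𝓡 d) 𝓘(ℝ, Idx n → Idx n → ℝ) ∞ (toArray j)) :
    ContDiffOn ℝ ∞ (arrayInChart d j) (extChartAt (𝓡 d) (1 : K)).target := by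
  have : IsManifold (𝓡 d) ∞ K := ContMDiffMul.toIsManifold
  rw [← contMDiffOn_iff_contDiffOn]
  exact hj.comp_contMDiffOn (contMDiffOn_extChartAt_symm 1)

theorem hasFDerivAt_arrayInChart
    (hj : ContMDiff (𝓡 d) 𝓘(ℝ, Idx n → Idx n → ℝ) ∞ (toArray j))
    {u : EuclideanSpace ℝ (Fin d)} (hu : u ∈ (extChartAt (𝓡 d) (1 : K)).target) :
    DifferentiableAt ℝ (arrayInChart d j) u :=
  ((contDiffOn_arrayInChart hj).contDiffAt
    ((isOpen_extChartAt_target (1 : K)).mem_nhds hu)).differentiableAt (by simp)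

theorem mfderiv_toArray
    (hj : ContMDiff (𝓡 d) 𝓘(ℝ, Idx n → Idx n → ℝ) ∞ (toArray j))
    {k : K} (hk : k ∈ (extChartAt (𝓡 d) (1 : K)).source) (v : TangentSpace (𝓡 d) k) :
    mfderiv (𝓡 d) 𝓘(ℝ, Idx n → Idx n → ℝ) (toArray j) k v
      = fderiv ℝ (arrayInChart d j) (extChartAt (𝓡 d) (1 : K) k)
          (mfderiv (𝓡 d) 𝓘(ℝ, EuclideanSpace ℝ (Fin d)) (extChartAt (𝓡 d) (1 : K)) k v) := by
  have : IsManifold (𝓡 d) ∞ K := ContMDiffMul.toIsManifold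
  have : IsManifold (𝓡 d) 1 K := IsManifold.of_le (n := ∞) (by simp)
  have hev : toArray j =ᶠ[𝓝 k] arrayInChart d j ∘ extChartAt (𝓡 d) (1 : K) := by
    filter_upwards [(isOpen_extChartAt_source (I := 𝓡 d) (1 : K)).mem_nhds hk] with k' hk'
    rw [Function.comp_apply, arrayInChart, Function.comp_apply,
      (extChartAt (𝓡 d) (1 : K)).left_inv hk']
  rw [hev.mfderiv_eq, mfderiv_comp (I' := 𝓘(ℝ, EuclideanSpace ℝ (Fin d))) k
    (hasFDerivAt_arrayInChart hj ((extChartAt (𝓡 d) (1 : K)).map_source hk)).mdifferentiableAt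
    (mdifferentiableAt_extChartAt (by simpa using hk)), mfderiv_eq_fderiv]
  rfl

/-- A Lie subgroup is tangent to the right invariant fields given by its Lie algebra. -/
theorem exists_fderiv_arrayInChart_eq
    (hj : ContMDiff (𝓡 d) 𝓘(ℝ, Idx n → Idx n → ℝ) ∞ (toArray j))
    {u : EuclideanSpace ℝ (Fin d)} (hu : u ∈ (extChartAt (𝓡 d) (1 : K)).target)
    {W : Matrix (Idx n) (Idx n) ℝ} (hW : W ∈ lieAlg d j) :
    ∃ z, fderiv ℝ (arrayInChart d j) u z = leftMul n W (arrayInChart d j u) := by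
  have : IsManifold (𝓡 d) ∞ K := ContMDiffMul.toIsManifold
  obtain ⟨v, hv⟩ := hW
  set k := (extChartAt (𝓡 d) (1 : K)).symm u with hk
  have hks : k ∈ (extChartAt (𝓡 d) (1 : K)).source := (extChartAt (𝓡 d) (1 : K)).map_target hu
  have hku : extChartAt (𝓡 d) (1 : K) k = u := (extChartAt (𝓡 d) (1 : K)).right_inv hu
  have hR : MDifferentiableAt (𝓡 d) (𝓡 d) (fun k' : K => k' * k) 1 :=
    (contMDiff_mul_right (I := 𝓡 d) (n := ∞) (a := k)).mdifferentiable (by simp) 1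
  have hj' : MDifferentiable (𝓡 d) 𝓘(ℝ, Idx n → Idx n → ℝ) (toArray j) :=
    hj.mdifferentiable (by simp)
  -- Right translation by `k` in `K` corresponds to right multiplication by `j k`. Differentiating
  -- at the unit along `v` exhibits `W (j k)` as a value of the differential of `j` at `k`.
  have hcomm : toArray j ∘ (fun k' : K => k' * k)
      = rightMul (j k : Matrix (Idx n) (Idx n) ℝ) ∘ toArray j := by
    funext k'
    change toArray j (k' * k) = rightMul _ (toArray j k')
    funext a b
    exact congrArg (fun T : GL (Idx n) ℝ => (T : Matrix (Idx n) (Idx n) ℝ) a b) (map_mul j k' k)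
  have e1 := mfderiv_comp_of_eq (I' := 𝓡 d) (x := (1 : K)) (hj' k) hR (one_mul k)
  have e2 := mfderiv_comp (I' := 𝓘(ℝ, Idx n → Idx n → ℝ)) (1 : K)
    (rightMul (j k : Matrix (Idx n) (Idx n) ℝ)).differentiableAt.mdifferentiableAt (hj' 1)
  rw [hcomm, e2] at e1
  have e3 := congrArg (fun T => T v) e1
  rw [mfderiv_eq_fderiv, ContinuousLinearMap.fderiv] at e3
  -- The translated vector is tangent at `1 * k`, which equals `k` only propositionally.
  have aux : ∀ k' : K, k' = k → ∀ w : TangentSpace (𝓡 d) k', ∃ w' : TangentSpace (𝓡 d) k,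
      (mfderiv (𝓡 d) 𝓘(ℝ, Idx n → Idx n → ℝ) (toArray j) k w' : Idx n → Idx n → ℝ)
        = mfderiv (𝓡 d) 𝓘(ℝ, Idx n → Idx n → ℝ) (toArray j) k' w := by
    rintro _ rfl w
    exact ⟨w, rfl⟩
  obtain ⟨w, hw⟩ := aux _ (one_mul k) (mfderiv (𝓡 d) (𝓡 d) (fun k' : K => k' * k) 1 v)
  refine ⟨mfderiv (𝓡 d) 𝓘(ℝ, EuclideanSpace ℝ (Fin d)) (extChartAt (𝓡 d) (1 : K)) k w, ?_⟩
  have e4 := mfderiv_toArray hj hks w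
  rw [hku] at e4
  refine e4.symm.trans (hw.trans (e3.symm.trans ?_))
  change rightMul (j k : Matrix (Idx n) (Idx n) ℝ)
    (mfderiv (𝓡 d) 𝓘(ℝ, Idx n → Idx n → ℝ) (toArray j) (1 : K) v) = _
  rw [hv]
  rfl

/-- The differential of a chart is invertible, so the immersion property at the unit passes to the
chart expression. -/
theorem injective_fderiv_arrayInChart
    (hj : ContMDiff (𝓡 d) 𝓘(ℝ, Idx n → Idx n → ℝ) ∞ (toArray j))
    (hinj : Function.Injective (mfderiv (𝓡 d) 𝓘(ℝ, Idx n → Idx n → ℝ) (toArray j) (1 : K))) :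
    Function.Injective
      (fderiv ℝ (arrayInChart d j) (extChartAt (𝓡 d) (1 : K) (1 : K))) := by
  have : IsManifold (𝓡 d) ∞ K := ContMDiffMul.toIsManifold
  have : IsManifold (𝓡 d) 1 K := IsManifold.of_le (n := ∞) (by simp)
  have hinv := isInvertible_mfderiv_extChartAt (I := 𝓡 d) (mem_extChartAt_source (I := 𝓡 d) (1 : K))
  obtain ⟨T, hT⟩ := hinv
  intro z z' hzz
  have hz (y : EuclideanSpace ℝ (Fin d)) :
      mfderiv (𝓡 d) 𝓘(ℝ, Idx n → Idx n → ℝ) (toArray j) (1 : K) (T.symm y)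
        = fderiv ℝ (arrayInChart d j) (extChartAt (𝓡 d) (1 : K) (1 : K)) y := by
    rw [mfderiv_toArray hj (mem_extChartAt_source (1 : K)), ← hT]
    exact congrArg _ (T.apply_symm_apply y)
  have := hinj ((hz z).trans (hzz.trans (hz z').symm))
  exact T.symm.injective this

/-- A local retraction onto a Lie subgroup, near the unit. -/
theorem exists_retraction
    (hj : ContMDiff (𝓡 d) 𝓘(ℝ, Idx n → Idx n → ℝ) ∞ (toArray j))
    (hinj : Function.Injective (mfderiv (𝓡 d) 𝓘(ℝ, Idx n → Idx n → ℝ) (toArray j) (1 : K))) :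
    ∃ (ρ : (Idx n → Idx n → ℝ) → (Idx n → Idx n → ℝ)) (C : ℝ), ρ (toArray j 1) = toArray j 1 ∧
      ∀ᶠ b in 𝓝 (toArray j 1), ρ b ∈ range (toArray j) ∧ DifferentiableAt ℝ ρ b ∧
        ‖fderiv ℝ ρ b‖ ≤ C ∧
        ∀ W ∈ lieAlg d j, fderiv ℝ ρ b (leftMul n W (ρ b)) = leftMul n W (ρ b) := by
  set ψ := arrayInChart d j with hψ
  set u₀ := extChartAt (𝓡 d) (1 : K) (1 : K) with hu₀
  have hu₀t : u₀ ∈ (extChartAt (𝓡 d) (1 : K)).target := mem_extChartAt_target (1 : K)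
  have hψu₀ : ψ u₀ = toArray j 1 := by
    simp [hψ, hu₀, arrayInChart]
  have hopen := isOpen_extChartAt_target (I := 𝓡 d) (1 : K)
  have hψd : ContDiffAt ℝ ∞ ψ u₀ := (contDiffOn_arrayInChart hj).contDiffAt (hopen.mem_nhds hu₀t)
  -- With `L` a linear left inverse of the differential of `ψ` at `u₀`, the map `L ∘ ψ` has identity
  -- derivative there and so a local inverse `g`. The retraction is `ψ ∘ g ∘ L`.
  obtain ⟨L', hL'⟩ := LinearMap.exists_leftInverse_of_injective
    (fderiv ℝ ψ u₀ : EuclideanSpace ℝ (Fin d) →ₗ[ℝ] Idx n → Idx n → ℝ)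
    (LinearMap.ker_eq_bot.2 (injective_fderiv_arrayInChart hj hinj))
  set L : (Idx n → Idx n → ℝ) →L[ℝ] EuclideanSpace ℝ (Fin d) := LinearMap.toContinuousLinearMap L'
  have hfd : ContDiffAt ℝ ∞ (L ∘ ψ) u₀ := L.contDiff.contDiffAt.comp u₀ hψd
  have hf' : HasFDerivAt (L ∘ ψ)
      (ContinuousLinearEquiv.refl ℝ (EuclideanSpace ℝ (Fin d)) : _ →L[ℝ] _) u₀ := by
    have h := L.hasFDerivAt.comp u₀ (hψd.differentiableAt (by simp)).hasFDerivAt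
    convert! h using 1
    ext1 z
    exact (LinearMap.congr_fun hL' z).symm
  have hstrict : HasStrictFDerivAt (L ∘ ψ)
      (ContinuousLinearEquiv.refl ℝ (EuclideanSpace ℝ (Fin d)) : _ →L[ℝ] _) u₀ :=
    hfd.hasStrictFDerivAt' hf' (by simp)
  set g := hstrict.localInverse (L ∘ ψ) _ u₀ with hg
  have hgd : ContDiffAt ℝ ∞ g (L (ψ u₀)) := hfd.to_localInverse hf' (by simp)
  have hgu₀ : g (L (ψ u₀)) = u₀ := hstrict.localInverse_apply_image
  have hleft : ∀ᶠ u in 𝓝 u₀, g (L (ψ u)) = u := hstrict.eventually_left_inverse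
  have hright : ∀ᶠ y in 𝓝 (L (ψ u₀)), L (ψ (g y)) = y := hstrict.eventually_right_inverse
  have hψgd : ContDiffAt ℝ 1 (ψ ∘ g) (L (ψ u₀)) := by
    refine ContDiffAt.comp _ ?_ (hgd.of_le (by simp))
    rw [hgu₀]
    exact hψd.of_le (by simp)
  have hρd : ContDiffAt ℝ 1 ((ψ ∘ g) ∘ L) (ψ u₀) := hψgd.comp _ L.contDiff.contDiffAt
  have hLc : Tendsto L (𝓝 (ψ u₀)) (𝓝 (L (ψ u₀))) := L.continuous.tendsto _
  have hgc : Tendsto g (𝓝 (L (ψ u₀))) (𝓝 u₀) := by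
    have := hgd.continuousAt.tendsto
    rwa [hgu₀] at this
  refine ⟨(ψ ∘ g) ∘ L, ‖fderiv ℝ ((ψ ∘ g) ∘ L) (ψ u₀)‖ + 1, ?_, ?_⟩
  · rw [← hψu₀]
    simp [hgu₀]
  · rw [← hψu₀]
    have e1 : ∀ᶠ b in 𝓝 (ψ u₀), ‖fderiv ℝ ((ψ ∘ g) ∘ L) b‖
        < ‖fderiv ℝ ((ψ ∘ g) ∘ L) (ψ u₀)‖ + 1 :=
      (hρd.fderiv_right (m := 0) (by simp)).continuousAt.norm.eventually_lt_const (lt_add_one _)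
    have e2 : ∀ᶠ y in 𝓝 (L (ψ u₀)), DifferentiableAt ℝ (ψ ∘ g) y :=
      (hψgd.eventually (by simp)).mono fun x hx => hx.differentiableAt one_ne_zero
    filter_upwards [e1, hLc.eventually e2, hLc.eventually hright,
      (hgc.comp hLc).eventually hleft.eventually_nhds,
      (hgc.comp hLc).eventually (hopen.mem_nhds hu₀t)] with b h1 h2 h3 h4 h5
    -- The derivative of `ρ` at a point depends only on the image of that point under `L`. As `L (ρ
    -- b) = L b`, it is the same at `b` and at `ρ b`.
    have hρ' (b' : Idx n → Idx n → ℝ) (hb' : L b' = L b) :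
        HasFDerivAt ((ψ ∘ g) ∘ L) (fderiv ℝ (ψ ∘ g) (L b) ∘L L) b' := by
      rw [← hb'] at h2 ⊢
      exact h2.hasFDerivAt.comp b' L.hasFDerivAt
    refine ⟨⟨(extChartAt (𝓡 d) (1 : K)).symm (g (L b)), rfl⟩, (hρ' b rfl).differentiableAt,
      h1.le, fun W hW => ?_⟩
    obtain ⟨z, hz⟩ := exists_fderiv_arrayInChart_eq hj h5 hW
    change fderiv ℝ ((ψ ∘ g) ∘ L) b (leftMul n W (ψ (g (L b)))) = leftMul n W (ψ (g (L b)))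
    change fderiv ℝ ψ (g (L b)) z = leftMul n W (ψ (g (L b))) at hz
    rw [← hz, (hρ' b rfl).fderiv, ← (hρ' (ψ (g (L b))) h3).fderiv]
    have hψ' : HasFDerivAt ψ (fderiv ℝ ψ (g (L b))) (g (L b)) :=
      (hasFDerivAt_arrayInChart hj h5).hasFDerivAt
    have hc := (hρ' (ψ (g (L b))) h3).comp (g (L b)) hψ'
    -- Near `g (L b)` the retraction fixes the image of `ψ`, so its derivative fixes the vectors
    -- tangent to that image.
    have hev : ((ψ ∘ g) ∘ L) ∘ ψ =ᶠ[𝓝 (g (L b))] ψ := by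
      filter_upwards [h4] with u hu
      simp only [Function.comp_apply, hu]
    have := (hc.congr_of_eventuallyEq hev.symm).unique hψ'
    rw [(hρ' (ψ (g (L b))) h3).fderiv]
    exact DFunLike.congr_fun this z

/-- A solution of a linear equation with coefficients in the Lie algebra of a Lie subgroup that
starts at the unit and remains close to it ends in the Lie subgroup. -/
theorem exists_pos_forall_mem_range
    (hj : ContMDiff (𝓡 d) 𝓘(ℝ, Idx n → Idx n → ℝ) ∞ (toArray j))
    (hinj : Function.Injective (mfderiv (𝓡 d) 𝓘(ℝ, Idx n → Idx n → ℝ) (toArray j) (1 : K))) :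
    ∃ δ > 0, ∀ (B : ℝ → Idx n → Idx n → ℝ)
      (D : ℝ → (Idx n → Idx n → ℝ) →L[ℝ] (Idx n → Idx n → ℝ)) (C : ℝ),
      (∀ t ∈ Icc (0 : ℝ) 1, HasDerivWithinAt B (D t (B t)) (Icc 0 1) t) → B 0 = toArray j 1 →
      (∀ t ∈ Icc (0 : ℝ) 1, B t ∈ ball (toArray j 1) δ) → (∀ t ∈ Icc (0 : ℝ) 1, ‖D t‖ ≤ C) →
      (∀ t ∈ Icc (0 : ℝ) 1, ∃ W ∈ lieAlg d j, D t = leftMul n W) →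
      B 1 ∈ range (toArray j) := by
  obtain ⟨ρ, C₁, hρ1, hev⟩ := exists_retraction hj hinj
  obtain ⟨δ, hδ, hball⟩ := Metric.eventually_nhds_iff_ball.1 hev
  refine ⟨δ, hδ, fun B D C hB hB0 hBδ hD hW => ?_⟩
  have hd : ∀ t ∈ Icc (0 : ℝ) 1, HasDerivWithinAt (fun t => B t - ρ (B t))
      (D t (B t) - fderiv ℝ ρ (B t) (D t (B t))) (Icc 0 1) t := fun t ht =>
    (hB t ht).sub ((hball _ (hBδ t ht)).2.1.hasFDerivAt.comp_hasDerivWithinAt t (hB t ht))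
  have hz := eq_zero_of_abs_deriv_le_mul_abs_self_of_eq_zero_right
    (f := fun t => B t - ρ (B t)) (f' := fun t => D t (B t) - fderiv ℝ ρ (B t) (D t (B t)))
    (K := C + C₁ * C) (a := 0) (b := 1) (fun t ht => (hd t ht).continuousWithinAt)
    (fun t ht => (hd t ⟨ht.1, ht.2.le⟩).mono_of_mem_nhdsWithin (Icc_mem_nhdsGE_of_mem ht))
    (by simp [hB0, hρ1]) (fun t ht' => by
      have ht : t ∈ Icc (0 : ℝ) 1 := ⟨ht'.1, ht'.2.le⟩
      obtain ⟨W, hWl, hDW⟩ := hW t ht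
      obtain ⟨-, -, h3, h4⟩ := hball _ (hBδ t ht)
      -- `D t (ρ (B t))` is tangent to the chart piece and fixed by the derivative of `ρ`, so
      -- subtracting it changes nothing. The result is linear in `B t - ρ (B t)`, which gives the
      -- rate `C + C₁ * C`.
      have e : D t (B t) - fderiv ℝ ρ (B t) (D t (B t))
          = D t (B t - ρ (B t)) - fderiv ℝ ρ (B t) (D t (B t - ρ (B t))) := by
        simp only [map_sub]
        rw [hDW, h4 W hWl]
        abel
      have hb : ‖D t (B t - ρ (B t))‖ ≤ C * ‖B t - ρ (B t)‖ :=
        (ContinuousLinearMap.le_opNorm _ _).trans (by gcongr; exact hD t ht)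
      have hC₁ : 0 ≤ C₁ := (norm_nonneg _).trans h3
      rw [e]
      calc _ ≤ _ := norm_sub_le _ _
        _ ≤ C * ‖B t - ρ (B t)‖ + C₁ * (C * ‖B t - ρ (B t)‖) :=
          add_le_add hb ((ContinuousLinearMap.le_opNorm _ _).trans (by gcongr))
        _ = _ := by ring) 1 (by simp)
  have h1 : (1 : ℝ) ∈ Icc (0 : ℝ) 1 := by simp
  rw [sub_eq_zero.1 hz]
  exact (hball _ (hBδ 1 h1)).1

end LieSubgroup

end NeutralBundle

/-! ### Coordinate vector fields and smoothness of covariant derivatives. -/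

namespace NeutralBundle

open Set Metric Filter
open scoped Topology

section Coordinates

variable {m : ℕ} {M : Type*} [TopologicalSpace M] [ChartedSpace (EuclideanSpace ℝ (Fin m)) M]

/-- The coordinate vector fields of the chart at `x₀`. -/
noncomputable def coordField (x₀ : M) (v : EuclideanSpace ℝ (Fin m)) :
    Π x : M, TangentSpace (𝓡 m) x :=
  mpullback (𝓡 m) 𝓘(ℝ, EuclideanSpace ℝ (Fin m)) (extChartAt (𝓡 m) x₀) (fun _ => v)

theorem coordField_add (x₀ : M) (v w : EuclideanSpace ℝ (Fin m)) (x : M) :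
    coordField x₀ (v + w) x = coordField x₀ v x + coordField x₀ w x :=
  map_add (mfderiv (𝓡 m) 𝓘(ℝ, EuclideanSpace ℝ (Fin m)) (extChartAt (𝓡 m) x₀) x).inverse v w

theorem coordField_smul (x₀ : M) (c : ℝ) (v : EuclideanSpace ℝ (Fin m)) (x : M) :
    coordField x₀ (c • v) x = c • coordField x₀ v x :=
  map_smul (mfderiv (𝓡 m) 𝓘(ℝ, EuclideanSpace ℝ (Fin m)) (extChartAt (𝓡 m) x₀) x).inverse c v

variable [IsManifold (𝓡 m) ∞ M] {x₀ x : M}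

theorem coordField_mfderiv (hx : x ∈ (extChartAt (𝓡 m) x₀).source) (X : TangentSpace (𝓡 m) x) :
    coordField x₀ (mfderiv (𝓡 m) 𝓘(ℝ, EuclideanSpace ℝ (Fin m)) (extChartAt (𝓡 m) x₀) x X) x
      = X := by
  have : IsManifold (𝓡 m) 1 M := IsManifold.of_le (n := ∞) (by simp)
  exact (isInvertible_mfderiv_extChartAt hx).inverse_apply_eq.2 rfl

theorem mfderiv_coordField (hx : x ∈ (extChartAt (𝓡 m) x₀).source)
    (v : EuclideanSpace ℝ (Fin m)) :
    mfderiv (𝓡 m) 𝓘(ℝ, EuclideanSpace ℝ (Fin m)) (extChartAt (𝓡 m) x₀) x (coordField x₀ v x)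
      = v := by
  have : IsManifold (𝓡 m) 1 M := IsManifold.of_le (n := ∞) (by simp)
  exact ((isInvertible_mfderiv_extChartAt hx).inverse_apply_eq.1 rfl).symm

theorem contMDiffAt_coordField (hx : x ∈ (extChartAt (𝓡 m) x₀).source)
    (v : EuclideanSpace ℝ (Fin m)) :
    ContMDiffAt (𝓡 m) (𝓡 m).tangent ∞ (fun y =>
      (TotalSpace.mk' (EuclideanSpace ℝ (Fin m)) y (coordField x₀ v y) : TangentBundle (𝓡 m) M))
      x := by
  have : IsManifold (𝓡 m) 1 M := IsManifold.of_le (n := ∞) (by simp)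
  refine ContMDiffAt.mpullback_vectorField_preimage (n := ∞) ?_
    (contMDiffAt_extChartAt' (by simpa using hx)) (isInvertible_mfderiv_extChartAt hx) (by simp)
  exact (contMDiffAt_vectorSpace_iff_contDiffAt (V := fun _ => v)).2 contDiffAt_const

/-- Pullback commutes with brackets, and constant fields commute. This removes the bracket term from
the curvature. -/
theorem mlieBracket_coordField (hx : x ∈ (extChartAt (𝓡 m) x₀).source)
    (v w : EuclideanSpace ℝ (Fin m)) :
    mlieBracket (𝓡 m) (coordField x₀ v) (coordField x₀ w) x = 0 := by
  have : IsManifold (𝓡 m) (minSmoothness ℝ 2) M := by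
    rw [minSmoothness_of_isRCLikeNormedField]
    exact IsManifold.of_le (n := ∞) ENat.LEInfty.out
  have hd (v : EuclideanSpace ℝ (Fin m)) (y : EuclideanSpace ℝ (Fin m)) :
      MDifferentiableAt 𝓘(ℝ, EuclideanSpace ℝ (Fin m)) 𝓘(ℝ, EuclideanSpace ℝ (Fin m)).tangent
        (fun z => (TotalSpace.mk' (EuclideanSpace ℝ (Fin m)) z v :
          TangentBundle 𝓘(ℝ, EuclideanSpace ℝ (Fin m)) (EuclideanSpace ℝ (Fin m)))) y :=
    ((contMDiffAt_vectorSpace_iff_contDiffAt (n := 1)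
      (V := fun _ => v)).2 contDiffAt_const).mdifferentiableAt one_ne_zero
  have h := mpullback_mlieBracket (I := 𝓡 m) (I' := 𝓘(ℝ, EuclideanSpace ℝ (Fin m))) (n := ∞)
    (f := extChartAt (𝓡 m) x₀) (V := fun _ => v) (W := fun _ => w) (x₀ := x) (hd v _) (hd w _)
    (contMDiffAt_extChartAt' (by simpa using hx))
    (by rw [minSmoothness_of_isRCLikeNormedField]; exact ENat.LEInfty.out)
  refine h.symm.trans ?_
  have h0 : mlieBracket 𝓘(ℝ, EuclideanSpace ℝ (Fin m))
      (fun _ : EuclideanSpace ℝ (Fin m) => v) (fun _ => w) = 0 := by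
    refine (mlieBracketWithin_eq_lieBracketWithin (V := fun _ => v) (W := fun _ => w)
      (s := univ)).trans ?_
    funext y
    change fderivWithin ℝ (fun _ : EuclideanSpace ℝ (Fin m) => w) univ y v
      - fderivWithin ℝ (fun _ : EuclideanSpace ℝ (Fin m) => v) univ y w = 0
    simp
  rw [h0, mpullback_zero]
  rfl

theorem mvfderiv_comp_extChartAt (hx : x ∈ (extChartAt (𝓡 m) x₀).source)
    {f : EuclideanSpace ℝ (Fin m) → ℝ} (hf : DifferentiableAt ℝ f (extChartAt (𝓡 m) x₀ x))
    (X : TangentSpace (𝓡 m) x) :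
    mvfderiv (𝓡 m) (f ∘ extChartAt (𝓡 m) x₀) x X = fderiv ℝ f (extChartAt (𝓡 m) x₀ x)
      (mfderiv (𝓡 m) 𝓘(ℝ, EuclideanSpace ℝ (Fin m)) (extChartAt (𝓡 m) x₀) x X) := by
  have : IsManifold (𝓡 m) 1 M := IsManifold.of_le (n := ∞) (by simp)
  have h := mfderiv_comp (I' := 𝓘(ℝ, EuclideanSpace ℝ (Fin m))) x hf.mdifferentiableAt
    (mdifferentiableAt_extChartAt (x := x₀) (by simpa using hx))
  rw [mfderiv_eq_fderiv] at h
  exact DFunLike.congr_fun h X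

theorem contDiffAt_comp_extChartAt_symm {S : Type*} [NormedAddCommGroup S] [NormedSpace ℝ S]
    {k : ℕ∞} {g : M → S} {y : EuclideanSpace ℝ (Fin m)} (hy : y ∈ (extChartAt (𝓡 m) x₀).target)
    (hg : ContMDiffAt (𝓡 m) 𝓘(ℝ, S) k g ((extChartAt (𝓡 m) x₀).symm y)) :
    ContDiffAt ℝ k (g ∘ (extChartAt (𝓡 m) x₀).symm) y := by
  rw [← contMDiffAt_iff_contDiffAt]
  refine ContMDiffAt.comp y hg ?_
  exact ((contMDiffOn_extChartAt_symm (I := 𝓡 m) (n := ∞) x₀).contMDiffAt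
    ((isOpen_extChartAt_target x₀).mem_nhds hy)).of_le (by exact_mod_cast le_top)

theorem mvfderiv_coordField (hx : x ∈ (extChartAt (𝓡 m) x₀).source) {g : M → ℝ}
    (hg : ContMDiffAt (𝓡 m) 𝓘(ℝ, ℝ) 1 g x) (v : EuclideanSpace ℝ (Fin m)) :
    mvfderiv (𝓡 m) g x (coordField x₀ v x)
      = fderiv ℝ (g ∘ (extChartAt (𝓡 m) x₀).symm) (extChartAt (𝓡 m) x₀ x) v := by
  have hd : DifferentiableAt ℝ (g ∘ (extChartAt (𝓡 m) x₀).symm) (extChartAt (𝓡 m) x₀ x) := by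
    refine (contDiffAt_comp_extChartAt_symm (k := 1) ((extChartAt (𝓡 m) x₀).map_source hx)
      ?_).differentiableAt one_ne_zero
    rwa [(extChartAt (𝓡 m) x₀).left_inv hx]
  have hev : g =ᶠ[𝓝 x] (g ∘ (extChartAt (𝓡 m) x₀).symm) ∘ extChartAt (𝓡 m) x₀ := by
    filter_upwards [(isOpen_extChartAt_source (I := 𝓡 m) x₀).mem_nhds hx] with y hy
    simp only [Function.comp_apply, (extChartAt (𝓡 m) x₀).left_inv hy]
  have h := mvfderiv_comp_extChartAt hx hd (coordField x₀ v x)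
  rw [mfderiv_coordField hx] at h
  rw [← h]
  have h2 := hev.mfderiv_eq (I := 𝓡 m) (I' := 𝓘(ℝ, ℝ))
  exact DFunLike.congr_fun h2 _

end Coordinates

section Bundle

variable {n m : ℕ}
  {M : Type*} [TopologicalSpace M] [ChartedSpace (EuclideanSpace ℝ (Fin m)) M]
  {F : Type*} [NormedAddCommGroup F] [NormedSpace ℝ F]
  {E : M → Type*} [TopologicalSpace (TotalSpace F E)]
  [∀ x, AddCommGroup (E x)] [∀ x, Module ℝ (E x)] [∀ x, TopologicalSpace (E x)]
  [∀ x, IsTopologicalAddGroup (E x)] [∀ x, ContinuousSMul ℝ (E x)]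
  [FiberBundle F E] [VectorBundle ℝ F E]

/-- The Leibniz rule for a combination of sections. -/
theorem cov_sum_smul (cov : CovariantDerivative (𝓡 m) F E) {ι : Type*} (t : Finset ι)
    {s : ι → Π x, E x} {g : ι → M → ℝ} {x : M}
    (hs : ∀ a, MDifferentiableAt (𝓡 m) ((𝓡 m).prod 𝓘(ℝ, F))
      (fun y => TotalSpace.mk' F y (s a y)) x)
    (hg : ∀ a, MDifferentiableAt (𝓡 m) 𝓘(ℝ, ℝ) (g a) x) :
    cov (fun y => ∑ a ∈ t, g a y • s a y) x
      = ∑ a ∈ t, (g a x • cov (s a) x + (mvfderiv (𝓡 m) (g a) x).smulRight (s a x)) := by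
  classical
  induction t using Finset.induction_on with
  | empty =>
    simp only [Finset.sum_empty]
    exact congrFun cov.zero x
  | insert a t ha ih =>
    have h1 : MDifferentiableAt (𝓡 m) ((𝓡 m).prod 𝓘(ℝ, F))
        (fun y => TotalSpace.mk' F y ((g a • s a) y)) x := (hg a).smul_section (hs a)
    have h2 : MDifferentiableAt (𝓡 m) ((𝓡 m).prod 𝓘(ℝ, F))
        (fun y => TotalSpace.mk' F y (∑ b ∈ t, g b y • s b y)) x :=
      MDifferentiableAt.sum_section fun b _ => (hg b).smul_section (hs b)
    rw [Finset.sum_insert ha, ← ih,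
      ← cov.isCovariantDerivativeOnUniv.leibniz (hs a) (hg a),
      ← cov.isCovariantDerivativeOnUniv.add h1 h2]
    congr 1
    funext y
    simp only [Finset.sum_insert ha]
    rfl

theorem contMDiffAt_metric {h : Π x, E x →L[ℝ] E x →L[ℝ] ℝ} (hh : IsNeutralMetric m n F h)
    {σ τ : Π x, E x} {x : M}
    (hσ : ContMDiffAt (𝓡 m) ((𝓡 m).prod 𝓘(ℝ, F)) ∞ (fun y => TotalSpace.mk' F y (σ y)) x)
    (hτ : ContMDiffAt (𝓡 m) ((𝓡 m).prod 𝓘(ℝ, F)) ∞ (fun y => TotalSpace.mk' F y (τ y)) x) :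
    ContMDiffAt (𝓡 m) 𝓘(ℝ, ℝ) ∞ (fun y => h y (σ y) (τ y)) x := by
  have : ContMDiffAt (𝓡 m) ((𝓡 m).prod 𝓘(ℝ)) ∞
      (fun y => TotalSpace.mk' ℝ (E := Bundle.Trivial M ℝ) y (h y (σ y) (τ y))) x :=
    ContMDiffAt.clm_bundle_apply₂ (F₁ := F) (F₂ := F) (b := fun y => y)
      (ψ := fun y => (h y : E y →L[ℝ] E y →L[ℝ] Bundle.Trivial M ℝ y))
      hh.contMDiff.contMDiffAt hσ hτ
  simp only [contMDiffAt_totalSpace] at this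
  exact this.2

variable [T2Space M] [IsManifold (𝓡 m) ∞ M]

/-- A smooth connection maps local smooth sections to smooth sections. -/
theorem contMDiffAt_cov (cov : CovariantDerivative (𝓡 m) F E)
    [CovariantDerivative.ContMDiffCovariantDerivative cov ∞] {U : Set M} (hU : IsOpen U)
    {σ : Π x, E x}
    (hσ : ContMDiffOn (𝓡 m) ((𝓡 m).prod 𝓘(ℝ, F)) ∞ (fun y => TotalSpace.mk' F y (σ y)) U)
    {x : M} (hx : x ∈ U) :
    ContMDiffAt (𝓡 m) ((𝓡 m).prod 𝓘(ℝ, EuclideanSpace ℝ (Fin m) →L[ℝ] F)) ∞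
      (fun y => TotalSpace.mk' (EuclideanSpace ℝ (Fin m) →L[ℝ] F)
        (E := fun y => TangentSpace (𝓡 m) y →L[ℝ] E y) y (cov σ y)) x := by
  -- Smoothness of the connection is applied to global sections, so the local section is cut off by
  -- a bump function; near `x` the covariant derivative is unchanged.
  obtain ⟨χ, -, hχ⟩ := (SmoothBumpFunction.nhds_basis_tsupport (I := 𝓡 m) x).mem_iff.1
    (hU.mem_nhds hx)
  have hsm : ContMDiff (𝓡 m) ((𝓡 m).prod 𝓘(ℝ, F)) ∞
      (fun y => TotalSpace.mk' F y (((χ : M → ℝ) • σ) y)) :=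
    ContMDiffOn.smul_section_of_tsupport χ.contMDiff.contMDiffOn hU hχ hσ
  have hc := (CovariantDerivative.ContMDiffCovariantDerivative.contMDiff
    (cov := cov) (k := ∞)).contMDiff (σ := (χ : M → ℝ) • σ) hsm.contMDiffOn
  refine (hc.contMDiffAt univ_mem).congr_of_eventuallyEq ?_
  filter_upwards [χ.eventuallyEq_one.eventuallyEq_nhds, hU.mem_nhds hx] with y hy hyU
  have : cov σ y = cov ((χ : M → ℝ) • σ) y := by
    refine cov.isCovariantDerivativeOnUniv.congr_of_eventuallyEq
      (((hσ y hyU).contMDiffAt (hU.mem_nhds hyU)).mdifferentiableAt (by simp))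
      (hsm.contMDiffAt.mdifferentiableAt (by simp)) univ_mem ?_
    filter_upwards [hy] with z hz
    simp [hz]
  rw [this]

end Bundle

end NeutralBundle

/-! ### The connection form of a pseudo-orthonormal frame and its structure equation. -/

namespace NeutralBundle

open Set Metric Filter
open scoped Topology

/-- The diagonal of the Gram matrix. -/
def gramSign {n : ℕ} (p : Idx n) : ℝ := if p.1 < 2 then 1 else -1

theorem gramSign_mul_self {n : ℕ} (p : Idx n) : gramSign p * gramSign p = 1 := by
  unfold gramSign
  split_ifs <;> norm_num

theorem gram_apply {n : ℕ} (p q : Idx n) : gram n p q = if p = q then gramSign p else 0 :=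
  Matrix.diagonal_apply _ p q

theorem sum_apply_mul_gramSign {n : ℕ} (c : Idx n → ℝ) (b : Idx n) :
    gramSign b * ∑ a, c a * gram n b a = c b := by
  simp only [gram_apply, mul_ite, mul_zero, Finset.sum_ite_eq, Finset.mem_univ, if_true]
  rw [mul_comm, mul_assoc, gramSign_mul_self, mul_one]

section Bundle

set_option synthInstance.maxHeartbeats 200000

variable {n m : ℕ}
  {M : Type*} [TopologicalSpace M] [ChartedSpace (EuclideanSpace ℝ (Fin m)) M]
  {F : Type*} [NormedAddCommGroup F] [NormedSpace ℝ F]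
  {E : M → Type*} [TopologicalSpace (TotalSpace F E)]
  [∀ x, AddCommGroup (E x)] [∀ x, Module ℝ (E x)] [∀ x, TopologicalSpace (E x)]
  [∀ x, IsTopologicalAddGroup (E x)] [∀ x, ContinuousSMul ℝ (E x)]
  [FiberBundle F E]

/-- `s` is a smooth pseudo-orthonormal frame field on the open set `U`, described by means of the
coefficients of vectors with respect to it. -/
structure IsOrthoFrame (m : ℕ) {M : Type*} [TopologicalSpace M]
    [ChartedSpace (EuclideanSpace ℝ (Fin m)) M]
    (F : Type*) [NormedAddCommGroup F] [NormedSpace ℝ F]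
    {E : M → Type*} [TopologicalSpace (TotalSpace F E)]
    [∀ x, AddCommGroup (E x)] [∀ x, Module ℝ (E x)] [∀ x, TopologicalSpace (E x)]
    [∀ x, IsTopologicalAddGroup (E x)] [∀ x, ContinuousSMul ℝ (E x)] [FiberBundle F E]
    (h : Π x, E x →L[ℝ] E x →L[ℝ] ℝ) (U : Set M) (s : Idx n → Π x, E x) : Prop where
  isOpen : IsOpen U
  contMDiffOn : ∀ p, ContMDiffOn (𝓡 m) ((𝓡 m).prod 𝓘(ℝ, F)) ∞
    (fun y => TotalSpace.mk' F y (s p y)) U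
  orthonormal : ∀ x ∈ U, ∀ p q, h x (s p x) (s q x) = gram n p q
  sum_eq : ∀ x ∈ U, ∀ v : E x, v = ∑ a, (gramSign a * h x (s a x) v) • s a x

/-- The connection form of a pseudo-orthonormal frame field. -/
noncomputable def connMatrix (h : Π x, E x →L[ℝ] E x →L[ℝ] ℝ) (cov : CovariantDerivative (𝓡 m) F E)
    (s : Idx n → Π x, E x) (x : M) (X : TangentSpace (𝓡 m) x) : Matrix (Idx n) (Idx n) ℝ :=
  Matrix.of fun a p => gramSign a * h x (s a x) (cov (s p) x X)

variable {h : Π x, E x →L[ℝ] E x →L[ℝ] ℝ} {cov : CovariantDerivative (𝓡 m) F E}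
  {U : Set M} {s : Idx n → Π x, E x} {x : M}

theorem connMatrix_apply (X : TangentSpace (𝓡 m) x) (a p : Idx n) :
    connMatrix h cov s x X a p = gramSign a * h x (s a x) (cov (s p) x X) := rfl

theorem connMatrix_add (X Y : TangentSpace (𝓡 m) x) :
    connMatrix h cov s x (X + Y) = connMatrix h cov s x X + connMatrix h cov s x Y := by
  ext a p
  simp only [connMatrix_apply, Matrix.add_apply, map_add]
  ring

theorem connMatrix_smul (c : ℝ) (X : TangentSpace (𝓡 m) x) :
    connMatrix h cov s x (c • X) = c • connMatrix h cov s x X := by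
  ext a p
  simp only [connMatrix_apply, Matrix.smul_apply, map_smul, smul_eq_mul]
  ring

namespace IsOrthoFrame

theorem cov_eq (hs : IsOrthoFrame m F h U s) (hx : x ∈ U) (X : TangentSpace (𝓡 m) x) (p : Idx n) :
    cov (s p) x X = ∑ a, connMatrix h cov s x X a p • s a x :=
  hs.sum_eq x hx _

theorem coeff_sum (hs : IsOrthoFrame m F h U s) (hx : x ∈ U) (c : Idx n → ℝ) (b : Idx n) :
    gramSign b * h x (s b x) (∑ a, c a • s a x) = c b := by
  simp only [map_sum, map_smul, hs.orthonormal x hx, smul_eq_mul]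
  exact sum_apply_mul_gramSign c b

theorem connMatrix_eq (hs : IsOrthoFrame m F h U s) (hx : x ∈ U) {X : TangentSpace (𝓡 m) x}
    {W : Matrix (Idx n) (Idx n) ℝ}
    (hW : (fun p => cov (s p) x X) = rowMul (fun q => s q x) W) :
    connMatrix h cov s x X = W := by
  ext a p
  rw [connMatrix_apply, congrFun hW p]
  exact hs.coeff_sum hx (fun b => W b p) a

theorem contMDiffAt (hs : IsOrthoFrame m F h U s) (hx : x ∈ U) (p : Idx n) :
    ContMDiffAt (𝓡 m) ((𝓡 m).prod 𝓘(ℝ, F)) ∞ (fun y => TotalSpace.mk' F y (s p y)) x :=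
  (hs.contMDiffOn p).contMDiffAt (hs.isOpen.mem_nhds hx)

theorem isOpen_chart_preimage (hs : IsOrthoFrame m F h U s) (x₀ : M) :
    IsOpen ((extChartAt (𝓡 m) x₀).target ∩ (extChartAt (𝓡 m) x₀).symm ⁻¹' U) :=
  (continuousOn_extChartAt_symm x₀).isOpen_inter_preimage (isOpen_extChartAt_target x₀) hs.isOpen

end IsOrthoFrame

/-- Multiplication by an array on the left, as a continuous linear map. -/
noncomputable def leftMulL (n : ℕ) :
    (Idx n → Idx n → ℝ) →L[ℝ] ((Idx n → Idx n → ℝ) →L[ℝ] (Idx n → Idx n → ℝ)) :=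
  LinearMap.toContinuousLinearMap ((leftMul n).comp (Matrix.ofLinearEquiv ℝ).toLinearMap)

theorem leftMulL_apply (W : Idx n → Idx n → ℝ) : leftMulL n W = leftMul n (Matrix.of W) := rfl

theorem leftMul_mul (W W' : Matrix (Idx n) (Idx n) ℝ) :
    leftMul n (W * W') = leftMul n W ∘L leftMul n W' := by
  ext1 B
  exact congrArg Matrix.of.symm (Matrix.mul_assoc W W' (Matrix.of B))

/-- The connection form, in the chart at `x₀`, acting on square arrays. -/
noncomputable def connForm (h : Π x, E x →L[ℝ] E x →L[ℝ] ℝ) (cov : CovariantDerivative (𝓡 m) F E)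
    (s : Idx n → Π x, E x) (x₀ : M) (y : EuclideanSpace ℝ (Fin m)) :
    EuclideanSpace ℝ (Fin m) →L[ℝ] (Idx n → Idx n → ℝ) →L[ℝ] (Idx n → Idx n → ℝ) :=
  LinearMap.toContinuousLinearMap
    { toFun := fun v => leftMul n (connMatrix h cov s ((extChartAt (𝓡 m) x₀).symm y)
        (coordField x₀ v ((extChartAt (𝓡 m) x₀).symm y)))
      map_add' := fun v w => by rw [coordField_add, connMatrix_add, map_add]
      map_smul' := fun c v => by rw [coordField_smul, connMatrix_smul, map_smul]; rfl }

theorem connForm_apply (x₀ : M) (y v : EuclideanSpace ℝ (Fin m)) :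
    connForm h cov s x₀ y v = leftMul n (connMatrix h cov s ((extChartAt (𝓡 m) x₀).symm y)
      (coordField x₀ v ((extChartAt (𝓡 m) x₀).symm y))) := rfl

/-- The entries of the connection form in the chart at `x₀`. -/
noncomputable def connArray (h : Π x, E x →L[ℝ] E x →L[ℝ] ℝ) (cov : CovariantDerivative (𝓡 m) F E)
    (s : Idx n → Π x, E x) (x₀ : M) (v y : EuclideanSpace ℝ (Fin m)) : Idx n → Idx n → ℝ :=
  fun a p => ((fun x => connMatrix h cov s x (coordField x₀ v x) a p) ∘
    (extChartAt (𝓡 m) x₀).symm) y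

theorem connForm_eq (x₀ : M) (v : EuclideanSpace ℝ (Fin m)) :
    (fun y => connForm h cov s x₀ y v) = fun y => leftMulL n (connArray h cov s x₀ v y) := rfl

variable [VectorBundle ℝ F E] [T2Space M] [IsManifold (𝓡 m) ∞ M]
  [CovariantDerivative.ContMDiffCovariantDerivative cov ∞]

namespace IsOrthoFrame

theorem contMDiffAt_cov_coordField (hs : IsOrthoFrame m F h U s) {x₀ : M} (hx : x ∈ U)
    (hx' : x ∈ (extChartAt (𝓡 m) x₀).source) (v : EuclideanSpace ℝ (Fin m)) (p : Idx n) :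
    ContMDiffAt (𝓡 m) ((𝓡 m).prod 𝓘(ℝ, F)) ∞
      (fun y => TotalSpace.mk' F y (cov (s p) y (coordField x₀ v y))) x :=
  have : IsManifold (𝓡 m) 1 M := IsManifold.of_le (n := ∞) (by simp)
  (contMDiffAt_cov cov hs.isOpen (hs.contMDiffOn p) hx).clm_bundle_apply
    (contMDiffAt_coordField hx' v)

theorem contMDiffAt_connMatrix (hs : IsOrthoFrame m F h U s) (hh : IsNeutralMetric m n F h)
    {x₀ : M} (hx : x ∈ U) (hx' : x ∈ (extChartAt (𝓡 m) x₀).source)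
    (v : EuclideanSpace ℝ (Fin m)) (a p : Idx n) :
    ContMDiffAt (𝓡 m) 𝓘(ℝ, ℝ) ∞ (fun y => connMatrix h cov s y (coordField x₀ v y) a p) x :=
  contMDiffAt_const.mul
    (contMDiffAt_metric hh (hs.contMDiffAt hx a) (hs.contMDiffAt_cov_coordField hx hx' v p))

/-- The Leibniz rule applied to the expansion of the first covariant derivative in the frame, valid
on a neighbourhood of `x`. -/
theorem coeff_cov_cov (hs : IsOrthoFrame m F h U s) (hh : IsNeutralMetric m n F h)
    {x₀ : M} (hx : x ∈ U) (hx' : x ∈ (extChartAt (𝓡 m) x₀).source)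
    (v w : EuclideanSpace ℝ (Fin m)) (b p : Idx n) :
    gramSign b * h x (s b x) (cov (fun y => cov (s p) y (coordField x₀ w y)) x (coordField x₀ v x))
      = (connMatrix h cov s x (coordField x₀ v x) * connMatrix h cov s x (coordField x₀ w x)) b p
        + mvfderiv (𝓡 m) (fun y => connMatrix h cov s y (coordField x₀ w y) b p) x
            (coordField x₀ v x) := by
  have hsd (a : Idx n) := (hs.contMDiffAt hx a).mdifferentiableAt (by simp)
  have hgd (a : Idx n) := (hs.contMDiffAt_connMatrix (cov := cov) hh hx hx' w a p).mdifferentiableAt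
    (by simp)
  have e : cov (fun y => cov (s p) y (coordField x₀ w y)) x
      = cov (fun y => ∑ a, connMatrix h cov s y (coordField x₀ w y) a p • s a y) x := by
    refine cov.isCovariantDerivativeOnUniv.congr_of_eventuallyEq
      ((hs.contMDiffAt_cov_coordField hx hx' w p).mdifferentiableAt (by simp))
      (MDifferentiableAt.sum_section fun a _ => (hgd a).smul_section (hsd a)) univ_mem ?_
    filter_upwards [hs.isOpen.mem_nhds hx] with y hy
    exact hs.cov_eq hy _ p
  rw [e, cov_sum_smul cov Finset.univ hsd hgd, sum_apply]
  simp only [add_apply, smul_apply,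
    ContinuousLinearMap.smulRight_apply, Finset.sum_add_distrib, map_add, mul_add]
  congr 1
  · rw [Matrix.mul_apply, map_sum, Finset.mul_sum]
    refine Finset.sum_congr rfl fun a _ => ?_
    rw [map_smul, smul_eq_mul, connMatrix_apply (a := b) (p := a)]
    ring
  · exact hs.coeff_sum hx _ b

/-- Cartan's equation `dω + ω ∧ ω = 0` on coordinate fields: antisymmetrise the second covariant
derivatives and use that coordinate fields commute. -/
theorem structure_equation (hs : IsOrthoFrame m F h U s) (hh : IsNeutralMetric m n F h)
    (hflat : IsFlat cov) {x₀ : M} (hx : x ∈ U) (hx' : x ∈ (extChartAt (𝓡 m) x₀).source)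
    (v w : EuclideanSpace ℝ (Fin m)) (b p : Idx n) :
    mvfderiv (𝓡 m) (fun y => connMatrix h cov s y (coordField x₀ w y) b p) x (coordField x₀ v x)
      - mvfderiv (𝓡 m) (fun y => connMatrix h cov s y (coordField x₀ v y) b p) x
          (coordField x₀ w x)
      + (connMatrix h cov s x (coordField x₀ v x) * connMatrix h cov s x (coordField x₀ w x)) b p
      - (connMatrix h cov s x (coordField x₀ w x) * connMatrix h cov s x (coordField x₀ v x)) b p
      = 0 := by
  have hR := hflat (U ∩ (extChartAt (𝓡 m) x₀).source)
    (hs.isOpen.inter (isOpen_extChartAt_source x₀)) (coordField x₀ v) (coordField x₀ w) (s p)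
    (fun y hy => (contMDiffAt_coordField hy.2 v).contMDiffWithinAt)
    (fun y hy => (contMDiffAt_coordField hy.2 w).contMDiffWithinAt)
    ((hs.contMDiffOn p).mono inter_subset_left) x ⟨hx, hx'⟩
  rw [curvature, mlieBracket_coordField hx', map_zero, sub_zero] at hR
  have h1 := congrArg (fun z => gramSign b * h x (s b x) z) hR
  simp only [map_sub, mul_sub, map_zero, mul_zero, hs.coeff_cov_cov hh hx hx'] at h1
  linarith

theorem contDiffAt_connArray (hs : IsOrthoFrame m F h U s) (hh : IsNeutralMetric m n F h)
    {x₀ : M} {y : EuclideanSpace ℝ (Fin m)} (hy : y ∈ (extChartAt (𝓡 m) x₀).target)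
    (hyU : (extChartAt (𝓡 m) x₀).symm y ∈ U) (v : EuclideanSpace ℝ (Fin m)) :
    ContDiffAt ℝ ∞ (connArray h cov s x₀ v) y := by
  refine contDiffAt_pi.2 fun a => contDiffAt_pi.2 fun p => ?_
  exact contDiffAt_comp_extChartAt_symm (k := ⊤) hy
    (hs.contMDiffAt_connMatrix hh hyU ((extChartAt (𝓡 m) x₀).map_target hy) v a p)

theorem contDiffOn_connForm (hs : IsOrthoFrame m F h U s) (hh : IsNeutralMetric m n F h)
    (x₀ : M) : ContDiffOn ℝ ∞ (connForm h cov s x₀)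
      ((extChartAt (𝓡 m) x₀).target ∩ (extChartAt (𝓡 m) x₀).symm ⁻¹' U) := by
  refine contDiffOn_clm_apply.2 fun v => ?_
  rw [connForm_eq]
  exact (leftMulL n).contDiff.comp_contDiffOn
    fun y hy => (hs.contDiffAt_connArray hh hy.1 hy.2 v).contDiffWithinAt

theorem contDiffAt_connForm (hs : IsOrthoFrame m F h U s) (hh : IsNeutralMetric m n F h)
    {x₀ : M} {y : EuclideanSpace ℝ (Fin m)} (hy : y ∈ (extChartAt (𝓡 m) x₀).target)
    (hyU : (extChartAt (𝓡 m) x₀).symm y ∈ U) :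
    ContDiffAt ℝ ∞ (connForm h cov s x₀) y :=
  (hs.contDiffOn_connForm hh x₀).contDiffAt ((hs.isOpen_chart_preimage x₀).mem_nhds ⟨hy, hyU⟩)

/-- Left multiplication turns matrix products into compositions, so the structure equation becomes
the integrability condition of `du = -ω u` for matrix-valued `u`. -/
theorem connForm_flat (hs : IsOrthoFrame m F h U s) (hh : IsNeutralMetric m n F h)
    (hflat : IsFlat cov)
    {x₀ : M} {y : EuclideanSpace ℝ (Fin m)} (hy : y ∈ (extChartAt (𝓡 m) x₀).target)
    (hyU : (extChartAt (𝓡 m) x₀).symm y ∈ U) (v w : EuclideanSpace ℝ (Fin m)) :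
    fderiv ℝ (connForm h cov s x₀) y v w - fderiv ℝ (connForm h cov s x₀) y w v
      + connForm h cov s x₀ y v ∘L connForm h cov s x₀ y w
      - connForm h cov s x₀ y w ∘L connForm h cov s x₀ y v = 0 := by
  have hd : DifferentiableAt ℝ (connForm h cov s x₀) y :=
    (hs.contDiffAt_connForm hh hy hyU).differentiableAt (by simp)
  have hxs := (extChartAt (𝓡 m) x₀).map_target hy
  have key (v w : EuclideanSpace ℝ (Fin m)) : fderiv ℝ (connForm h cov s x₀) y v w
      = leftMulL n (fun a p => mvfderiv (𝓡 m)
          (fun x => connMatrix h cov s x (coordField x₀ w x) a p)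
          ((extChartAt (𝓡 m) x₀).symm y) (coordField x₀ v ((extChartAt (𝓡 m) x₀).symm y))) := by
    have h1 := hd.hasFDerivAt.clm_apply (hasFDerivAt_const w y)
    have hc : DifferentiableAt ℝ (connArray h cov s x₀ w) y :=
      (hs.contDiffAt_connArray hh hy hyU w).differentiableAt (by simp)
    have h2 : HasFDerivAt (fun y => connForm h cov s x₀ y w)
        (leftMulL n ∘L fderiv ℝ (connArray h cov s x₀ w) y) y :=
      (leftMulL n).hasFDerivAt.comp y hc.hasFDerivAt
    have h3 := DFunLike.congr_fun (h1.unique h2) v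
    rw [add_apply, ContinuousLinearMap.comp_apply, zero_apply, map_zero, zero_add,
      ContinuousLinearMap.flip_apply] at h3
    have h4 : fderiv ℝ (connForm h cov s x₀) y v w
        = leftMulL n (fderiv ℝ (connArray h cov s x₀ w) y v) := h3
    rw [h4]
    congr 1
    funext a p
    have h5 := hasFDerivAt_pi'.1 (hasFDerivAt_pi'.1 hc.hasFDerivAt a) p
    have h6 := mvfderiv_coordField hxs
      ((hs.contMDiffAt_connMatrix (cov := cov) hh hyU hxs w a p).of_le (by simp)) v
    rw [(extChartAt (𝓡 m) x₀).right_inv hy] at h6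
    rw [h6]
    exact (DFunLike.congr_fun h5.fderiv v).symm
  rw [key v w, key w v, connForm_apply, connForm_apply, ← leftMul_mul, ← leftMul_mul,
    leftMulL_apply, leftMulL_apply, ← map_sub, ← map_add, ← map_sub, ← map_zero (leftMul n)]
  congr 1
  ext a p
  exact hs.structure_equation hh hflat hyU hxs v w a p

end IsOrthoFrame

end Bundle

end NeutralBundle

/-! ### Parallel changes of frame with values in the Lie subgroup. -/

namespace NeutralBundle

open Set Metric Filter
open scoped Topology

section Integration

set_option synthInstance.maxHeartbeats 200000

variable {n m d : ℕ}
  {M : Type*} [TopologicalSpace M] [ChartedSpace (EuclideanSpace ℝ (Fin m)) M]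
  [IsManifold (𝓡 m) ∞ M]
  {F : Type*} [NormedAddCommGroup F] [NormedSpace ℝ F]
  {E : M → Type*} [TopologicalSpace (TotalSpace F E)]
  [∀ x, AddCommGroup (E x)] [∀ x, Module ℝ (E x)] [∀ x, TopologicalSpace (E x)]
  [∀ x, IsTopologicalAddGroup (E x)] [∀ x, ContinuousSMul ℝ (E x)]
  [FiberBundle F E] [VectorBundle ℝ F E]
  {h : Π x, E x →L[ℝ] E x →L[ℝ] ℝ} {cov : CovariantDerivative (𝓡 m) F E}
  {U : Set M} {s : Idx n → Π x, E x}

/-- `∇(s u) = s (du + ω u) = 0`, read column by column. The constant `c` makes room for the sign by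
which `I'` multiplies a column. -/
theorem IsOrthoFrame.cov_sum_eq_zero (hs : IsOrthoFrame m F h U s)
    {x₀ x : M} (hx : x ∈ U) (hx' : x ∈ (extChartAt (𝓡 m) x₀).source)
    {u : EuclideanSpace ℝ (Fin m) → Idx n → Idx n → ℝ}
    (hu : HasFDerivAt u (-((connForm h cov s x₀ (extChartAt (𝓡 m) x₀ x)).flip
      (u (extChartAt (𝓡 m) x₀ x)))) (extChartAt (𝓡 m) x₀ x)) (c : ℝ) (p : Idx n) :
    cov (fun y => ∑ a, (c * u (extChartAt (𝓡 m) x₀ y) a p) • s a y) x = 0 := by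
  have hua (a : Idx n) := (hasFDerivAt_pi'.1 (hasFDerivAt_pi'.1 hu a) p).const_mul c
  have hm : IsManifold (𝓡 m) 1 M := IsManifold.of_le (n := ∞) (by simp)
  have hgd (a : Idx n) : MDifferentiableAt (𝓡 m) 𝓘(ℝ, ℝ)
      (fun y => c * u (extChartAt (𝓡 m) x₀ y) a p) x :=
    (hua a).differentiableAt.mdifferentiableAt.comp x
      (mdifferentiableAt_extChartAt (by simpa using hx'))
  rw [cov_sum_smul cov Finset.univ
    (fun a => (hs.contMDiffAt hx a).mdifferentiableAt (by simp)) hgd]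
  ext1 X
  rw [sum_apply, zero_apply]
  have hmv (a : Idx n) : mvfderiv (𝓡 m) (fun y => c * u (extChartAt (𝓡 m) x₀ y) a p) x X
      = -(c * ∑ b, connMatrix h cov s x X a b * u (extChartAt (𝓡 m) x₀ x) b p) := by
    have h1 := mvfderiv_comp_extChartAt hx' (hua a).differentiableAt X
    rw [(hua a).fderiv] at h1
    refine h1.trans ?_
    have h2 : connForm h cov s x₀ (extChartAt (𝓡 m) x₀ x)
        (mfderiv (𝓡 m) 𝓘(ℝ, EuclideanSpace ℝ (Fin m)) (extChartAt (𝓡 m) x₀) x X)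
        = leftMul n (connMatrix h cov s x X) := by
      refine (connForm_apply x₀ _ _).trans (congrArg (leftMul n) ?_)
      -- The chart returns to `x` only propositionally, and the tangent space depends on the point;
      -- hence the general `z`.
      have h3 (z : M) (hz : z = x) (v : EuclideanSpace ℝ (Fin m)) (hv : coordField x₀ v x = X) :
          connMatrix h cov s z (coordField x₀ v z) = connMatrix h cov s x X := by
        subst hz
        rw [hv]
      exact h3 _ ((extChartAt (𝓡 m) x₀).left_inv hx') _ (coordField_mfderiv hx' X)
    change c * ((-((connForm h cov s x₀ (extChartAt (𝓡 m) x₀ x)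
      (mfderiv (𝓡 m) 𝓘(ℝ, EuclideanSpace ℝ (Fin m)) (extChartAt (𝓡 m) x₀) x X))
      (u (extChartAt (𝓡 m) x₀ x)))) a p) = _
    rw [h2, leftMul_apply, Pi.neg_apply, Pi.neg_apply, mul_neg]
    rfl
  simp only [add_apply, smul_apply, ContinuousLinearMap.smulRight_apply, hmv, hs.cov_eq hx,
    Finset.sum_add_distrib, Finset.smul_sum, neg_smul, smul_smul, Finset.sum_neg_distrib]
  rw [Finset.sum_comm, add_neg_eq_zero]
  refine Finset.sum_congr rfl fun a _ => ?_
  rw [← Finset.sum_smul, Finset.mul_sum]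
  congr 1
  refine Finset.sum_congr rfl fun b _ => ?_
  ring

variable [T2Space M] [CovariantDerivative.ContMDiffCovariantDerivative cov ∞]
  {K : Type*} [TopologicalSpace K] [ChartedSpace (EuclideanSpace ℝ (Fin d)) K] [Group K]
  [LieGroup (𝓡 d) ∞ K] {j : K →* GL (Idx n) ℝ}

/-- The change of frame that makes a frame of a flat bundle parallel takes its values in a given Lie
subgroup as soon as the connection form takes its values in its Lie algebra. -/
theorem IsOrthoFrame.exists_parallel_array (hs : IsOrthoFrame m F h U s)
    (hh : IsNeutralMetric m n F h) (hflat : IsFlat cov)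
    (hj : ContMDiff (𝓡 d) 𝓘(ℝ, Idx n → Idx n → ℝ) ∞ (toArray j))
    (hinj : Function.Injective (mfderiv (𝓡 d) 𝓘(ℝ, Idx n → Idx n → ℝ) (toArray j) (1 : K)))
    {x₀ : M} (hx₀ : x₀ ∈ U)
    (hW : ∀ x ∈ U, ∀ X : TangentSpace (𝓡 m) x, connMatrix h cov s x X ∈ lieAlg d j) :
    ∃ r > 0, ∃ u : EuclideanSpace ℝ (Fin m) → Idx n → Idx n → ℝ,
      ball (extChartAt (𝓡 m) x₀ x₀) r
        ⊆ (extChartAt (𝓡 m) x₀).target ∩ (extChartAt (𝓡 m) x₀).symm ⁻¹' U ∧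
      ContDiffOn ℝ ∞ u (ball (extChartAt (𝓡 m) x₀ x₀) r) ∧
      ∀ y ∈ ball (extChartAt (𝓡 m) x₀ x₀) r,
        HasFDerivAt u (-((connForm h cov s x₀ y).flip (u y))) y ∧ u y ∈ range (toArray j) := by
  set y₀ := extChartAt (𝓡 m) x₀ x₀ with hy₀
  set T := (extChartAt (𝓡 m) x₀).target ∩ (extChartAt (𝓡 m) x₀).symm ⁻¹' U with hT
  have hTo : IsOpen T := hs.isOpen_chart_preimage x₀
  have hy₀T : y₀ ∈ T := ⟨mem_extChartAt_target x₀, by simpa [hy₀] using hx₀⟩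
  obtain ⟨δ, hδ, hK⟩ := exists_pos_forall_mem_range hj hinj
  obtain ⟨r₁, hr₁, u, hu₀, hu⟩ := FlatLinearSystem.exists_parallel
    (Ω := connForm h cov s x₀) (x₀ := y₀)
    ((hs.contDiffAt_connForm hh hy₀T.1 hy₀T.2).of_le ENat.LEInfty.out)
    (by
      filter_upwards [hTo.mem_nhds hy₀T] with y hy v w
      exact hs.connForm_flat hh hflat hy.1 hy.2 v w) (toArray j 1)
  have huc : ContinuousAt u y₀ := (hu y₀ (mem_ball_self hr₁)).continuousAt
  -- The radius also keeps `u` within `δ` of the unit, where the retraction onto the chart piece of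
  -- `K` is available.
  obtain ⟨r, hr, hball⟩ := Metric.eventually_nhds_iff_ball.1
    ((eventually_mem_set.2 (ball_mem_nhds y₀ hr₁)).and ((eventually_mem_set.2
      (hTo.mem_nhds hy₀T)).and (huc.eventually (ball_mem_nhds (u y₀) hδ))))
  have hΩ : ContDiffOn ℝ ∞ (connForm h cov s x₀) (ball y₀ r) :=
    (hs.contDiffOn_connForm hh x₀).mono fun y hy => (hball y hy).2.1
  have hu' : ∀ y ∈ ball y₀ r, HasFDerivAt u (-((connForm h cov s x₀ y).flip (u y))) y :=
    fun y hy => hu y (hball y hy).1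
  refine ⟨r, hr, u, fun y hy => (hball y hy).2.1,
    FlatLinearSystem.contDiffOn_of_parallel isOpen_ball hΩ hu', fun y hy => ⟨hu' y hy, ?_⟩⟩
  have hpath : ∀ t ∈ Icc (0 : ℝ) 1, y₀ + t • (y - y₀) ∈ ball y₀ r := fun t ht =>
    (convex_ball y₀ r).add_smul_sub_mem (mem_ball_self hr) hy ht
  have hpathc : ContinuousOn (fun t : ℝ => y₀ + t • (y - y₀)) (Icc 0 1) := by fun_prop
  -- The sign in `du = -ω u` is carried by the vector `-(y - y₀)`, so each coefficient is itself a
  -- value of the connection form and lies in the Lie algebra.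
  have hDc : ContinuousOn (fun t : ℝ => connForm h cov s x₀ (y₀ + t • (y - y₀)) (-(y - y₀)))
      (Icc 0 1) := (hΩ.continuousOn.comp hpathc hpath).clm_apply continuousOn_const
  obtain ⟨C, hC⟩ := isCompact_Icc.exists_bound_of_continuousOn hDc
  have := hK (fun t => u (y₀ + t • (y - y₀)))
    (fun t => connForm h cov s x₀ (y₀ + t • (y - y₀)) (-(y - y₀))) C (fun t ht => ?_)
    (by simpa using hu₀) (fun t ht => hu₀ ▸ (hball _ (hpath t ht)).2.2) hC (fun t ht => ?_)
  · simpa using this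
  · have d1 : HasDerivAt (fun t : ℝ => y₀ + t • (y - y₀)) (y - y₀) t := by
      simpa using ((hasDerivAt_id t).smul_const (y - y₀)).const_add y₀
    have d2 := HasFDerivAt.comp_hasDerivAt (l := u) (f := fun t : ℝ => y₀ + t • (y - y₀)) t
      (hu' _ (hpath t ht)) d1
    refine (d2.congr_deriv ?_).hasDerivWithinAt
    rw [neg_apply, ContinuousLinearMap.flip_apply, map_neg, neg_apply]
  · exact ⟨_, hW _ (hball _ (hpath t ht)).2.1.2 _, connForm_apply x₀ _ _⟩

end Integration

/-! ### Row products, the sign matrix and signed frames. -/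

section RowMul

variable {n : ℕ} {W W' : Type*} [AddCommGroup W] [Module ℝ W] [AddCommGroup W'] [Module ℝ W']

theorem rowMul_rowMul (v : Idx n → W) (A B : Matrix (Idx n) (Idx n) ℝ) :
    rowMul (rowMul v A) B = rowMul v (A * B) := by
  funext c
  simp only [rowMul, Finset.smul_sum, smul_smul, Matrix.mul_apply, Finset.sum_smul]
  rw [Finset.sum_comm]
  refine Finset.sum_congr rfl fun a _ => Finset.sum_congr rfl fun b _ => ?_
  rw [mul_comm]

theorem rowMul_one (v : Idx n → W) : rowMul v 1 = v := by
  funext b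
  simp [rowMul, Matrix.one_apply, ite_smul]

theorem map_rowMul {T : Type*} [FunLike T W W'] [LinearMapClass T ℝ W W'] (f : T) (v : Idx n → W)
    (A : Matrix (Idx n) (Idx n) ℝ) (b : Idx n) :
    f (rowMul v A b) = rowMul (fun a => f (v a)) A b := by
  simp only [rowMul, map_sum, map_smul]

theorem bilin_rowMul [TopologicalSpace W] (f : W →L[ℝ] W →L[ℝ] ℝ) {v : Idx n → W}
    (hv : ∀ p q, f (v p) (v q) = gram n p q) (A : Matrix (Idx n) (Idx n) ℝ) (p q : Idx n) :
    f (rowMul v A p) (rowMul v A q) = (Aᵀ * gram n * A) p q := by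
  simp only [rowMul, map_sum, map_smul, sum_apply, smul_apply, hv, smul_eq_mul,
    Matrix.mul_apply, Matrix.transpose_apply, Finset.sum_mul]
  refine Finset.sum_congr rfl fun b _ => ?_
  rw [Finset.mul_sum]
  refine Finset.sum_congr rfl fun a _ => ?_
  ring

/-- The diagonal of `I'_{4n, ε}`. -/
def signEntry (ε : ℤˣ) (p : Idx n) : ℝ := if p.1 = 3 ∧ (p.2 : ℕ) = 0 then ((ε : ℤ) : ℝ) else 1

theorem signEntry_mul_self (ε : ℤˣ) (p : Idx n) : signEntry ε p * signEntry ε p = 1 := by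
  unfold signEntry
  split_ifs
  · rcases Int.units_eq_one_or ε with rfl | rfl <;> simp
  · simp

theorem signMatrix_eq (ε : ℤˣ) : signMatrix n ε = Matrix.diagonal (signEntry ε) := rfl

theorem signMatrix_mul_self (ε : ℤˣ) : signMatrix n ε * signMatrix n ε = 1 := by
  simp only [signMatrix_eq, Matrix.diagonal_mul_diagonal, signEntry_mul_self, Matrix.diagonal_one]

theorem signMatrix_conj_gram (ε : ℤˣ) :
    (signMatrix n ε)ᵀ * gram n * signMatrix n ε = gram n := by
  simp only [signMatrix_eq, gram, Matrix.diagonal_transpose, Matrix.diagonal_mul_diagonal]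
  congr 1
  funext p
  rw [mul_right_comm, signEntry_mul_self, one_mul]

theorem rowMul_signMatrix (ε : ℤˣ) (v : Idx n → W) (p : Idx n) :
    rowMul v (signMatrix n ε) p = signEntry ε p • v p := by
  simp [rowMul, signMatrix_eq, Matrix.diagonal_apply, ite_smul]

end RowMul

section Frames

variable {n m d : ℕ}
  {M : Type*} [TopologicalSpace M] [ChartedSpace (EuclideanSpace ℝ (Fin m)) M]
  {F : Type*} [NormedAddCommGroup F] [NormedSpace ℝ F]
  {E : M → Type*} [TopologicalSpace (TotalSpace F E)]
  [∀ x, AddCommGroup (E x)] [∀ x, Module ℝ (E x)] [∀ x, TopologicalSpace (E x)]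
  [∀ x, IsTopologicalAddGroup (E x)] [∀ x, ContinuousSMul ℝ (E x)]
  [FiberBundle F E] [VectorBundle ℝ F E]
  {h : Π x, E x →L[ℝ] E x →L[ℝ] ℝ} {o : Π x, Orientation ℝ (E x) (Idx n)} {ε : ℤˣ}
  {N : Π x, E x →L[ℝ] E x} {U : Set M} {e : Idx n → Π x, E x}

/-- The frame field `e I'_{4n, ε}`. -/
noncomputable def signedFrame (ε : ℤˣ) (e : Idx n → Π x, E x) : Idx n → Π x, E x :=
  fun p x => rowMul (fun q => e q x) (signMatrix n ε) p

/-- `I'` preserves the Gram matrix, and its signs enter squared in the expansion of a vector. -/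
theorem IsAdmissibleFrame.isOrthoFrame (he : IsAdmissibleFrame m F h o ε N U e) :
    IsOrthoFrame m F h U (signedFrame ε e) where
  isOpen := he.isOpen
  contMDiffOn p := by
    have := (he.frame.contMDiffOn p).const_smul_section (a := signEntry ε p)
    refine this.congr fun x _ => ?_
    simp only [signedFrame, rowMul_signMatrix]
    rfl
  orthonormal x hx p q := by
    have := bilin_rowMul (h x) (he.orthonormal x hx) (signMatrix n ε) p q
    rwa [signMatrix_conj_gram] at this
  sum_eq x hx v := by
    have hv := (he.frame.toBasisAt hx).sum_repr v
    simp only [IsLocalFrameOn.toBasisAt_coe] at hv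
    have hc (a : Idx n) : gramSign a * h x (e a x) v = (he.frame.toBasisAt hx).repr v a := by
      conv_lhs => rw [← hv]
      simp only [map_sum, map_smul, he.orthonormal x hx, smul_eq_mul]
      exact sum_apply_mul_gramSign _ a
    conv_lhs => rw [← hv]
    refine Finset.sum_congr rfl fun a _ => ?_
    rw [← hc a]
    simp only [signedFrame, rowMul_signMatrix, map_smul, smul_apply, smul_smul,
      smul_eq_mul]
    congr 1
    linear_combination -(gramSign a * h x (e a x) v) * signEntry_mul_self ε a

end Frames

end NeutralBundle

/-! ### Admissibility under a change of frame. -/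

namespace NeutralBundle

open Set Metric Filter
open scoped Topology

theorem rowMul_basis_det {n : ℕ} {W : Type*} [AddCommGroup W] [Module ℝ W]
    (b : Module.Basis (Idx n) ℝ W) (A : Matrix (Idx n) (Idx n) ℝ) :
    b.det (rowMul b A) = A.det := by
  rw [Module.Basis.det_apply]
  congr 1
  ext a p
  simp [Module.Basis.toMatrix_apply, rowMul, Finsupp.single_apply]

section Frames

variable {n m : ℕ}
  {M : Type*} [TopologicalSpace M] [ChartedSpace (EuclideanSpace ℝ (Fin m)) M]
  {F : Type*} [NormedAddCommGroup F] [NormedSpace ℝ F]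
  {E : M → Type*} [TopologicalSpace (TotalSpace F E)]
  [∀ x, AddCommGroup (E x)] [∀ x, Module ℝ (E x)] [∀ x, TopologicalSpace (E x)]
  [∀ x, IsTopologicalAddGroup (E x)] [∀ x, ContinuousSMul ℝ (E x)]
  [FiberBundle F E] [VectorBundle ℝ F E]
  {h : Π x, E x →L[ℝ] E x →L[ℝ] ℝ} {o : Π x, Orientation ℝ (E x) (Idx n)} {ε : ℤˣ}
  {N : Π x, E x →L[ℝ] E x} {U V : Set M} {e f : Idx n → Π x, E x}

/-- A change of frame by a smooth function with values in `G` preserves admissibility. -/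
theorem IsAdmissibleFrame.of_change (he : IsAdmissibleFrame m F h o ε N U e) (hV : IsOpen V)
    (hVU : V ⊆ U) {A : M → GL (Idx n) ℝ} (hAG : ∀ x ∈ V, A x ∈ G n)
    (hA : ∀ a p, ContMDiffOn (𝓡 m) 𝓘(ℝ, ℝ) ∞
      (fun x => (A x : Matrix (Idx n) (Idx n) ℝ) a p) V)
    (hf : ∀ x ∈ V, rowMul (fun q => f q x) (signMatrix n ε)
      = rowMul (fun q => signedFrame ε e q x) (A x : Matrix (Idx n) (Idx n) ℝ)) :
    IsAdmissibleFrame m F h o ε N V f := by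
  -- As `I'` is an involution, `f = e (I' A I')`; the conjugate has the determinant of `A`, namely
  -- 1, which gives both the basis property and the orientation.
  have hfe (x : M) (hx : x ∈ V) : (fun p => f p x) = rowMul (fun q => e q x)
      (signMatrix n ε * (A x : Matrix (Idx n) (Idx n) ℝ) * signMatrix n ε) := by
    have h1 := congrArg (fun v => rowMul v (signMatrix n ε)) (hf x hx)
    simp only [rowMul_rowMul, signMatrix_mul_self, rowMul_one] at h1
    rw [h1, Matrix.mul_assoc, ← rowMul_rowMul (fun q => e q x)]
    rfl
  have hdet (x : M) (hx : x ∈ V) :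
      (he.frame.toBasisAt (hVU hx)).det (fun p => f p x) = 1 := by
    have h1 : (fun p => f p x) = rowMul (he.frame.toBasisAt (hVU hx))
        (signMatrix n ε * (A x : Matrix (Idx n) (Idx n) ℝ) * signMatrix n ε) := by
      rw [hfe x hx]
      congr 1
      funext q
      simp
    have h2 := congrArg Matrix.det (signMatrix_mul_self (n := n) ε)
    rw [Matrix.det_mul, Matrix.det_one] at h2
    rw [h1, rowMul_basis_det, Matrix.det_mul, Matrix.det_mul, (hAG x hx).1.2, mul_one, h2]
  have hbasis (x : M) (hx : x ∈ V) := ((he.frame.toBasisAt (hVU hx)).is_basis_iff_det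
    (v := fun p => f p x)).2 ((hdet x hx).symm ▸ isUnit_one)
  have hframe : IsLocalFrameOn (𝓡 m) F ∞ f V :=
    { linearIndependent := fun hx => (hbasis _ hx).1
      generating := fun hx => (hbasis _ hx).2.ge
      contMDiffOn := fun p => by
        have h1 : ContMDiffOn (𝓡 m) ((𝓡 m).prod 𝓘(ℝ, F)) ∞ (fun x => TotalSpace.mk' F x
            (∑ a, (signEntry ε p * (A x : Matrix (Idx n) (Idx n) ℝ) a p) •
              signedFrame ε e a x)) V :=
          ContMDiffOn.sum_section fun a _ => (contMDiffOn_const.mul (hA a p)).smul_section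
            ((he.isOrthoFrame.contMDiffOn a).mono hVU)
        refine h1.congr fun x hx => ?_
        have h2 := congrFun (hf x hx) p
        rw [rowMul_signMatrix] at h2
        have h3 : f p x = signEntry ε p • signEntry ε p • f p x := by
          rw [smul_smul, signEntry_mul_self, one_smul]
        rw [h3, h2]
        simp only [rowMul, Finset.smul_sum, smul_smul] }
  refine ⟨hV, hframe, fun x hx p q => ?_, fun x hx => ?_, fun x hx => ?_⟩
  · have h1 := bilin_rowMul (h x) (he.isOrthoFrame.orthonormal x (hVU hx))
      ((A x : Matrix (Idx n) (Idx n) ℝ) * signMatrix n ε) p q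
    rw [← rowMul_rowMul, ← hf x hx, rowMul_rowMul, signMatrix_mul_self, rowMul_one] at h1
    rw [h1, Matrix.transpose_mul, Matrix.mul_assoc, Matrix.mul_assoc, ← Matrix.mul_assoc (gram n),
      ← Matrix.mul_assoc _ (gram n * _), ← Matrix.mul_assoc _ (gram n), (hAG x hx).1.1,
      ← Matrix.mul_assoc, signMatrix_conj_gram]
  · rw [← he.positive x (hVU hx), eq_comm, Module.Basis.orientation_eq_iff_det_pos]
    have h1 : (hframe.toBasisAt hx : Idx n → E x) = fun p => f p x := by
      funext p
      simp
    rw [h1, hdet x hx]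
    exact one_pos
  -- With `s = e I'`: `N (s A) = s Λ A = s A Λ`, since `A` commutes with `Λ`.
  · have h1 : (fun p => N x (signedFrame ε e p x)) = rowMul (fun q => signedFrame ε e q x) (Lam n) :=
      he.nilpotent x (hVU hx)
    rw [hf x hx, rowMul_rowMul, (hAG x hx).2, ← rowMul_rowMul, ← h1]
    funext p
    exact map_rowMul (N x) _ _ p

end Frames

end NeutralBundle

/-! ### The parallel `K`-admissible frame. -/

theorem proposition4p3
    {n m d : ℕ} (hn : 0 < n)
    {M : Type*} [TopologicalSpace M] [T2Space M]
    [ChartedSpace (EuclideanSpace ℝ (Fin m)) M] [IsManifold (𝓡 m) ∞ M]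
    {F : Type*} [NormedAddCommGroup F] [NormedSpace ℝ F] [FiniteDimensional ℝ F]
    (hF : Module.finrank ℝ F = 4 * n)
    {E : M → Type*} [TopologicalSpace (TotalSpace F E)]
    [∀ x, AddCommGroup (E x)] [∀ x, Module ℝ (E x)] [∀ x, TopologicalSpace (E x)]
    [∀ x, IsTopologicalAddGroup (E x)] [∀ x, ContinuousSMul ℝ (E x)]
    [FiberBundle F E] [VectorBundle ℝ F E] [ContMDiffVectorBundle ∞ F E (𝓡 m)]
    (o : Π x, Orientation ℝ (E x) (NeutralBundle.Idx n))
    (ho : NeutralBundle.IsBundleOrientation m F o)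
    (h : Π x, E x →L[ℝ] E x →L[ℝ] ℝ) (hh : NeutralBundle.IsNeutralMetric m n F h)
    (cov : CovariantDerivative (𝓡 m) F E) [CovariantDerivative.ContMDiffCovariantDerivative cov ∞]
    (hcov : NeutralBundle.IsMetricConnection h cov) (hflat : NeutralBundle.IsFlat cov)
    {K : Type*} [TopologicalSpace K] [T2Space K] [SecondCountableTopology K]
    [ChartedSpace (EuclideanSpace ℝ (Fin d)) K] [Group K] [LieGroup (𝓡 d) ∞ K]
    (j : K →* GL (NeutralBundle.Idx n) ℝ)
    (hK : NeutralBundle.IsLieSubgroup (d := d) (NeutralBundle.G n) j)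
    (ε : ℤˣ) (N : Π x, E x →L[ℝ] E x)
    {L : Type*} (U : L → Set M) (e : L → NeutralBundle.Idx n → Π x, E x)
    (hN : NeutralBundle.IsKNilpotent (d := d) j h o cov ε N U e) (x₀ : M) :
    ∃ (V : Set M) (f : NeutralBundle.Idx n → Π x, E x), x₀ ∈ V ∧
      NeutralBundle.IsKAdmissible m F j h o ε N U e V f ∧
      ∀ p, ∀ x ∈ V, cov (f p) x = 0 := by
  obtain ⟨l, hl⟩ := Set.mem_iUnion.1 (hN.cover ▸ Set.mem_univ x₀)
  have he := hN.admissible l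
  have hs := he.isOrthoFrame
  obtain ⟨r, hr, u, hball, husm, hu⟩ := hs.exists_parallel_array hh hflat hK.contMDiff
    (hK.immersion 1) hl (fun x hx X => by
      obtain ⟨W, hW, hWX⟩ := hN.connection l x hx X
      exact (hs.connMatrix_eq hx hWX).symm ▸ hW)
  set φ := extChartAt (𝓡 m) x₀ with hφ
  set V := φ.source ∩ φ ⁻¹' Metric.ball (φ x₀) r with hV
  have hVo : IsOpen V :=
    (continuousOn_extChartAt x₀).isOpen_inter_preimage (isOpen_extChartAt_source x₀)
      Metric.isOpen_ball
  have hVU : V ⊆ U l := fun x hx => by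
    have h1 := (hball hx.2).2
    rwa [Set.mem_preimage, φ.left_inv hx.1] at h1
  have hx₀V : x₀ ∈ V := ⟨mem_extChartAt_source x₀, Metric.mem_ball_self hr⟩
  choose k hk using fun x : V => (hu (φ x) x.2.2).2
  classical
  -- The value 1 outside `V` plays no role.
  let A : M → K := fun x => if hx : x ∈ V then k ⟨x, hx⟩ else 1
  have hA (x : M) (hx : x ∈ V) (a p : NeutralBundle.Idx n) :
      (j (A x) : Matrix (NeutralBundle.Idx n) (NeutralBundle.Idx n) ℝ) a p = u (φ x) a p := by
    simp only [A, dif_pos hx, ← hk ⟨x, hx⟩, NeutralBundle.toArray]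
  -- This is `s u I'`: the final `I'` multiplies column `p` by its sign, so that `f I' = s u`.
  let f : NeutralBundle.Idx n → Π x, E x := fun p x =>
    ∑ a, (NeutralBundle.signEntry ε p * u (φ x) a p) • NeutralBundle.signedFrame ε (e l) a x
  have hf (x : M) (hx : x ∈ V) :
      NeutralBundle.rowMul (fun q => f q x) (NeutralBundle.signMatrix n ε)
        = NeutralBundle.rowMul (fun q => NeutralBundle.signedFrame ε (e l) q x)
          (j (A x) : Matrix (NeutralBundle.Idx n) (NeutralBundle.Idx n) ℝ) := by
    funext p
    rw [NeutralBundle.rowMul_signMatrix]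
    simp only [f, NeutralBundle.rowMul, Finset.smul_sum, smul_smul,
      hA x hx, ← mul_assoc, NeutralBundle.signEntry_mul_self, one_mul]
  refine ⟨V, f, hx₀V, ⟨he.of_change hVo hVU (fun x _ => hK.range_le ⟨A x, rfl⟩)
    (fun a p => ?_) hf, fun l' hl' => ?_⟩, fun p x hx => hs.cov_sum_eq_zero (hVU hx) hx.1
      (hu _ hx.2).1 _ p⟩
  · have h1 : ContDiffOn ℝ ∞ (fun y => u y a p) (Metric.ball (φ x₀) r) :=
      contDiffOn_pi.1 (contDiffOn_pi.1 husm a) p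
    have h2 : ContMDiffOn (𝓡 m) 𝓘(ℝ, EuclideanSpace ℝ (Fin m)) ∞ φ V :=
      (contMDiffOn_extChartAt (x := x₀)).mono fun x hx => by simpa [hφ] using hx.1
    exact (h1.contMDiffOn.comp h2 fun x hx => hx.2).congr fun x hx => hA x hx a p
  -- From `e l I' = e l' I' A'` and `f I' = e l I' A` follows `f I' = e l' I' (A' A)`.
  · obtain ⟨A', hA'⟩ := hN.transition l' l (hl'.mono (Set.inter_subset_inter_right _ hVU))
    refine ⟨fun x => A' x * A x, fun x hx => ?_⟩
    rw [hf x hx.2, map_mul, Units.val_mul, ← NeutralBundle.rowMul_rowMul,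
      ← hA' x ⟨hx.1, hVU hx.2⟩]
    rfl
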